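/- There are universal constants $c,C>0$ such that the following holds for all integers $d,H\ge 1$, all $\rho\in(0,3/4]$, $\delta\in(0,1)$, $\lambda>0$ and every sample size $K> C\,d^6\log(2dH/\delta)$. **Hard instances.** Put $\eta=d^{3/2}/\sqrt{2K}$. For $\xi\in\{-1,1\}^{dH}$ let $M_\xi$ be the $d$-rectangular linear DRMDP (distributionally robust MDP) of feature dimension $d+2$ with horizon $H$, states $\mathcal S=\{x_1,x_2\}$, actions $\mathcal A=\{0,1\}^d$, features $$\phi(x_1,a)=\Big(\tfrac{a_1}{d},\dots,\tfrac{a_d}{d},1-\sum_{i=1}^d\tfrac{a_i}{d},0\Big),\qquad \phi(x_2,a)=(0,\dots,0,1),$$ nominal factor distributions $\mu^0_h=(\delta_{x_1},\dots,\delta_{x_1},\delta_{x_2})$ ($d+1$ copies of $\delta_{x_1}$), nominal kernels $P^0_h(\cdot|s,a)=\langle\phi(s,a),\mu^0_h(\cdot)\rangle$, mean rewards $r_h(s,a)=\langle\phi(s,a),\theta_h\rangle$ with $\theta_h=\eta\,\big(\tfrac{\xi_{h1}+1}{2},\dots,\tfrac{\xi_{hd}+1}{2},\tfrac12,0\big)$,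 and uncertainty set $\mathcal U^\rho(P^0)$ consisting of the kernels with $P_h(\cdot|s,a)=\sum_i\phi_i(s,a)\mu_{h,i}$, where, independently for every $(h,s,a)$, each $\mu_{h,i}$ is a probability measure on $\mathcal S$ within total variation distance $\rho$ of $\mu^0_{h,i}$ if $h=1$, and $\mu_{h,i}=\mu_{h,i}^0$ if $h\ge 2$. **Values.** For a (randomized Markov) policy $\pi$, $V_h^{\pi,\rho}(s)=\inf_{P\in\mathcal U^\rho(P^0)}\mathbb E^{\pi,P}[\sum_{t\ge h}r_t(s_t,a_t)\mid s_h=s]$, $V_h^{\star,\rho}=\sup_\pi V_h^{\pi,\rho}$, and $\mathrm{SubOpt}(M_\xi,\pi,s,\rho)=V_1^{\star,\rho}(s)-V_1^{\pi,\rho}(s)$. A policy $\pi^\star$ is optimal robust if $V_h^{\pi^\star,\rho}(s)=V_h^{\star,\rho}(s)$ for all $h\in[H]$ and $s\in\mathcal S$. **Data.** $\mathbb Q_\xi$ is the law of $\mathcal D$, consisting of $K$ i.i.d. trajectories $(s_h^\tau,a_h^\tau,r_h^\tau)_{h=1}^H$ from the nominal environment of $M_\xi$, with $s_1\sim\mu_0$,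 $\mu_0(x_1)=\frac{d+1}{d+2}$, $\mu_0(x_2)=\frac1{d+2}$, the actions drawn uniformly from $\{e_1,\dots,e_d,0\}$ at each step in each state, and $r_h\sim\mathcal N(r_h(s_h,a_h),1)$. Let $$\Lambda_h=\sum_{\tau=1}^K\phi(s_h^\tau,a_h^\tau)\phi(s_h^\tau,a_h^\tau)^\top+\lambda I,\qquad \Sigma_h^\star=\sum_{\tau=1}^K\frac{\phi(s_h^\tau,a_h^\tau)\phi(s_h^\tau,a_h^\tau)^\top}{\max\{1,[\mathrm{Var}_hV_{h+1}^{\star,\rho}](s_h^\tau,a_h^\tau)\}}+\lambda I,$$ where $\mathrm{Var}_h$ is the variance under $P_h^0(\cdot|s,a)$. **Conclusion.** (i) Every $M_\xi$ satisfies the linear MDP assumption: $\phi_i\ge0$, $\sum_i\phi_i=1$, the $\mu^0_{h,i}$ are probability measures, $r_h\in[0,1]$, $\|\theta_h\|_2\le\sqrt{d+2}$. It has an optimal robust policy, $\mathbb Q_\xi$ is a probability measure, and $\mathbb E[\phi(s_h,a_h)\phi(s_h,a_h)^\top]$ under the data distribution is positive definite for every $h$. For every dataset, $\Sigma_h^\star=\Lambda_h$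 for all $h$. (ii) For every $\xi$, with $\mathbb Q_\xi$-probability at least $1-\delta$ over the data $\mathcal D$ defining $\Lambda_h$, simultaneously for all $\xi'$ and all optimal robust policies $\pi^\star$ of $M_{\xi'}$, $$\inf_{\hat\pi}\,\sup_{\xi''\in\{-1,1\}^{dH}}\mathbb E_{\mathcal D'\sim\mathbb Q_{\xi''}}\big[\mathrm{SubOpt}(M_{\xi''},\hat\pi(\mathcal D'),x_1,\rho)\big]\;\ge\; c\cdot\sup_{P\in\mathcal U^\rho(P^0)}\sum_{h=1}^H\mathbb E^{\pi^\star,P}\Big[\sum_{i=1}^{d+2}\|\phi_i(s_h,a_h)\mathbf 1_i\|_{\Lambda_h^{-1}}\,\Big|\,s_1=x_1\Big],$$ where the infimum is over all measurable maps $\hat\pi$ from datasets to policies, $\mathbf 1_i$ is the $i$-th standard basis vector and $\|v\|_M=\sqrt{v^\top Mv}$. -/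

import Mathlib

open MeasureTheory ProbabilityTheory
open scoped BigOperators Matrix

noncomputable section

namespace RobustRL

/-! Steps `h ∈ [H]` are indexed by `Fin H` (so the first step is `0`), feature coordinates by `Fin n`. -/

/-- The data of a `d`-rectangular linear DRMDP of feature dimension `n`: feature map `φ`, nominal
factor distributions `μ h i`, reward parameters `θ h`, and the total variation radius `radius h` of
the factor uncertainty sets of step `h`. -/
structure LinearDRMDP (S A : Type) (n H : ℕ) where
  φ : S → A → Fin n → ℝ
  μ : Fin H → Fin n → S → ℝ
  θ : Fin H → Fin n → ℝ
  radius : Fin H → ℝ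

/-- (Randomized) Markov policies; deterministic decision rules are the vertices. -/
abbrev Policy (S A : Type) [Fintype A] (H : ℕ) : Type :=
  Fin H → S → stdSimplex ℝ A

/-- A family of transition probabilities `P h s a s'`. -/
abbrev Transition (S A : Type) (H : ℕ) : Type :=
  Fin H → S → A → S → ℝ

/-- `K` trajectories of `H` triples (state, action, observed reward). -/
abbrev Dataset (S A : Type) (H K : ℕ) : Type :=
  Fin K → Fin H → S × A × ℝ

/-- Total variation divergence of two mass functions. -/
def tvDist {S : Type} [Fintype S] (p q : S → ℝ) : ℝ :=
  (1 / 2) * ∑ s, |p s - q s|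

/-- `‖v‖_M = √(vᵀ M v)`. -/
def matNorm {n : ℕ} (M : Matrix (Fin n) (Fin n) ℝ) (v : Fin n → ℝ) : ℝ :=
  Real.sqrt (v ⬝ᵥ (M *ᵥ v))

/-- `E^{π,P}[∑_{t ≥ h} f_t(s_t, a_t) | s_h = s]`, by conditioning on the first action and the next
state; it is `0` after the last step. -/
def expectedSum {S A : Type} [Fintype S] [Fintype A] {H : ℕ} (f : Fin H → S → A → ℝ)
    (P : Transition S A H) (π : Policy S A H) (h : ℕ) (s : S) : ℝ :=
  if hh : h < H then
    ∑ a, (π ⟨h, hh⟩ s).1 a *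
      (f ⟨h, hh⟩ s a + ∑ s', P ⟨h, hh⟩ s a s' * expectedSum f P π (h + 1) s')
  else 0
termination_by H - h

/-- Probability of the state-action path `x` under initial distribution `init`, transitions `P` and
policy `π`. -/
def pathProb {S A : Type} [Fintype A] {H : ℕ} (init : S → ℝ) (P : Transition S A H)
    (π : Policy S A H) (x : Fin H → S × A) : ℝ :=
  ∏ h : Fin H,
    (if 0 < h.val then
        P ⟨h.val - 1, by omega⟩ (x ⟨h.val - 1, by omega⟩).1 (x ⟨h.val - 1, by omega⟩).2 (x h).1
      else init (x h).1) * (π h (x h).1).1 (x h).2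

namespace LinearDRMDP

section Basic

variable {S A : Type} {n H : ℕ}

/-- Mean reward `r_h(s,a) = ⟨φ(s,a), θ_h⟩`. -/
def reward (M : LinearDRMDP S A n H) (h : Fin H) (s : S) (a : A) : ℝ :=
  ∑ i, M.φ s a i * M.θ h i

/-- Nominal transitions `P⁰_h(·|s,a) = ⟨φ(s,a), μ⁰_h(·)⟩`. -/
def nominal (M : LinearDRMDP S A n H) : Transition S A H :=
  fun h s a s' => ∑ i, M.φ s a i * M.μ h i s'

/-- The linear MDP assumption, with the radii of the uncertainty sets nonnegative. -/
def IsLinear [Fintype S] (M : LinearDRMDP S A n H) : Prop :=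
  (∀ s a i, 0 ≤ M.φ s a i) ∧ (∀ s a, ∑ i, M.φ s a i = 1) ∧
  (∀ h i, M.μ h i ∈ stdSimplex ℝ S) ∧
  (∀ h, Real.sqrt (∑ i, M.θ h i ^ 2) ≤ Real.sqrt n) ∧
  (∀ h s a, 0 ≤ M.reward h s a ∧ M.reward h s a ≤ 1) ∧
  (∀ h, 0 ≤ M.radius h)

/-- Factor uncertainty set: the total variation ball around `μ⁰_{h,i}`. -/
def factorSet [Fintype S] (M : LinearDRMDP S A n H) (h : Fin H) (i : Fin n) : Set (S → ℝ) :=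
  {ν | ν ∈ stdSimplex ℝ S ∧ tvDist ν (M.μ h i) ≤ M.radius h}

/-- The uncertainty set `𝓤(P⁰)`: a product over steps and over state-action pairs. -/
def uncertaintySet [Fintype S] (M : LinearDRMDP S A n H) : Set (Transition S A H) :=
  {P | ∀ h s a, ∃ ν : Fin n → S → ℝ, (∀ i, ν i ∈ M.factorSet h i) ∧
    ∀ s', P h s a s' = ∑ i, M.φ s a i * ν i s'}

end Basic

section Values

variable {S A : Type} {n H : ℕ} [Fintype S] [Fintype A]

/-- Robust value function of `π`. -/
def robustValue (M : LinearDRMDP S A n H) (π : Policy S A H) (h : ℕ) (s : S) : ℝ :=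
  ⨅ P : M.uncertaintySet, expectedSum M.reward P.1 π h s

/-- Optimal robust value function. -/
def optValue (M : LinearDRMDP S A n H) (h : ℕ) (s : S) : ℝ :=
  ⨆ π : Policy S A H, M.robustValue π h s

/-- `π` is an optimal robust policy. -/
def IsOptimal (M : LinearDRMDP S A n H) (π : Policy S A H) : Prop :=
  ∀ (h : Fin H) (s : S), M.robustValue π h s = M.optValue h s

/-- Suboptimality gap of `π` from the initial state `s`. -/
def subOpt (M : LinearDRMDP S A n H) (π : Policy S A H) (s : S) : ℝ :=
  M.optValue 0 s - M.robustValue π 0 s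

/-- Variance of `V` at `P⁰_h(·|s,a)`. -/
def nominalVar (M : LinearDRMDP S A n H) (V : S → ℝ) (h : Fin H) (s : S) (a : A) : ℝ :=
  (∑ s', M.nominal h s a s' * V s' ^ 2) - (∑ s', M.nominal h s a s' * V s') ^ 2

/-- Truncated variance `max {1, Var}`. -/
def truncVar (M : LinearDRMDP S A n H) (V : S → ℝ) (h : Fin H) (s : S) (a : A) : ℝ :=
  max 1 (M.nominalVar V h s a)

/-- Empirical covariance `Λ_h = ∑_τ φ_h^τ (φ_h^τ)ᵀ + λ I`. -/
def empCov (M : LinearDRMDP S A n H) {K : ℕ} (lam : ℝ) (D : Dataset S A H K) (h : Fin H) :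
    Matrix (Fin n) (Fin n) ℝ :=
  (∑ τ, Matrix.vecMulVec (M.φ (D τ h).1 (D τ h).2.1) (M.φ (D τ h).1 (D τ h).2.1)) +
    lam • (1 : Matrix (Fin n) (Fin n) ℝ)

/-- Variance-weighted covariance
`Σ*_h = ∑_τ φ_h^τ (φ_h^τ)ᵀ / [𝕍_h V*_{h+1}](s_h^τ, a_h^τ) + λ I`. -/
def weightedCov (M : LinearDRMDP S A n H) {K : ℕ} (lam : ℝ) (D : Dataset S A H K) (h : Fin H) :
    Matrix (Fin n) (Fin n) ℝ :=
  (∑ τ, (M.truncVar (M.optValue (h.val + 1)) h (D τ h).1 (D τ h).2.1)⁻¹ •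
      Matrix.vecMulVec (M.φ (D τ h).1 (D τ h).2.1) (M.φ (D τ h).1 (D τ h).2.1)) +
    lam • (1 : Matrix (Fin n) (Fin n) ℝ)

/-- `sup_{P ∈ 𝓤(P⁰)} ∑_h E^{π,P}[∑_i ‖φ_i(s_h,a_h) 1_i‖_{G_h⁻¹} | s_1 = s]`. -/
def uncertaintyFn (M : LinearDRMDP S A n H) (G : Fin H → Matrix (Fin n) (Fin n) ℝ)
    (π : Policy S A H) (s : S) : ℝ :=
  ⨆ P : M.uncertaintySet,
    expectedSum (fun h s a => ∑ i, matNorm (G h)⁻¹ (Pi.single i (M.φ s a i))) P.1 π 0 s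

/-- Feature coverage: `E^{π,P⁰}[φ(s_h,a_h) φ(s_h,a_h)ᵀ]` is positive definite at every step. -/
def FeatureCoverage (M : LinearDRMDP S A n H) (init : S → ℝ) (π : Policy S A H) : Prop :=
  ∀ h : Fin H, (∑ x : Fin H → S × A, pathProb init M.nominal π x •
    Matrix.vecMulVec (M.φ (x h).1 (x h).2) (M.φ (x h).1 (x h).2)).PosDef

/-- Law of one trajectory collected by `π` in the nominal environment, where the reward observed at
step `h` is drawn from `N(r_h(s_h,a_h), 1)`. -/
def trajLaw [MeasurableSpace S] [MeasurableSpace A] (M : LinearDRMDP S A n H) (init : S → ℝ)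
    (π : Policy S A H) : Measure (Fin H → S × A × ℝ) :=
  ∑ x : Fin H → S × A, ENNReal.ofReal (pathProb init M.nominal π x) •
    Measure.pi (fun h => (Measure.dirac (x h).1).prod
      ((Measure.dirac (x h).2).prod (gaussianReal (M.reward h (x h).1 (x h).2) 1)))

/-- Law of a dataset of `K` i.i.d. trajectories. -/
def dataLaw [MeasurableSpace S] [MeasurableSpace A] (M : LinearDRMDP S A n H) (init : S → ℝ)
    (π : Policy S A H) (K : ℕ) : Measure (Dataset S A H K) :=
  Measure.pi (fun _ : Fin K => M.trajLaw init π)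

end Values

end LinearDRMDP

/-! ### The hard instances -/

/-- Two states, `x₁ = 0` and `x₂ = 1`. -/
abbrev HState : Type := Fin 2

/-- Actions `a ∈ {0,1}^d`. -/
abbrev HAction (d : ℕ) : Type := Fin d → Bool

/-- The entry `a_i ∈ {0,1}` as a real number. -/
def bit (b : Bool) : ℝ := if b then 1 else 0

/-- The separation parameter `d^{3/2} / √(2K)` of the rewards. -/
def gap (d K : ℕ) : ℝ := (d : ℝ) ^ (3 / 2 : ℝ) / Real.sqrt (2 * K)

/-- `φ(x₁,a) = (a_1/d, …, a_d/d, 1 - ∑ a_i/d, 0)` and `φ(x₂,a) = (0, …, 0, 0, 1)`. -/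
def hardFeature (d : ℕ) (s : HState) (a : HAction d) : Fin (d + 2) → ℝ :=
  if s = 0 then
    Fin.snoc (Fin.snoc (fun i : Fin d => bit (a i) / d) (1 - ∑ i, bit (a i) / d) :
      Fin (d + 1) → ℝ) 0
  else
    Fin.snoc (fun _ : Fin (d + 1) => (0 : ℝ)) 1

/-- The instance `M_ξ`, `ξ ∈ {-1,1}^{dH}`. Nominal factors are `(δ_{x₁}, …, δ_{x₁}, δ_{x₂})`,
`θ_h = gap · ((ξ_{h1}+1)/2, …, (ξ_{hd}+1)/2, 1/2, 0)`, and only the first step is uncertain. -/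
def hardInstance (d H K : ℕ) (ρ : ℝ) (ξ : Fin H → Fin d → ℤˣ) :
    LinearDRMDP HState (HAction d) (d + 2) H where
  φ := hardFeature d
  μ := fun _ => Fin.snoc (fun _ : Fin (d + 1) => (Pi.single 0 1 : HState → ℝ)) (Pi.single 1 1)
  θ := fun h i => gap d K *
    (Fin.snoc (Fin.snoc (fun i : Fin d => (((ξ h i : ℤ) : ℝ) + 1) / 2) (1 / 2) :
      Fin (d + 1) → ℝ) 0 : Fin (d + 2) → ℝ) i
  radius := fun h => if h.val = 0 then ρ else 0

/-- Initial distribution of the data: `μ₀(x₁) = (d+1)/(d+2)`, `μ₀(x₂) = 1/(d+2)`. -/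
def hardInit (d : ℕ) : HState → ℝ :=
  ![((d : ℝ) + 1) / (d + 2), 1 / ((d : ℝ) + 2)]

/-- The actions `e_1, …, e_d, 0`. -/
def probeActions (d : ℕ) : Finset (HAction d) :=
  insert (fun _ => false) (Finset.univ.image fun i : Fin d => fun j => decide (j = i))

/-- The uniform distribution on `{e_1, …, e_d, 0}`. -/
def probeDist (d : ℕ) : stdSimplex ℝ (HAction d) :=
  ⟨fun a => if a ∈ probeActions d then 1 / ((probeActions d).card : ℝ) else 0, by
    have hpos : (0 : ℝ) < (probeActions d).card := by
      exact_mod_cast Finset.card_pos.mpr ⟨_, Finset.mem_insert_self _ _⟩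
    refine ⟨fun a => ?_, ?_⟩
    · dsimp only
      split_ifs
      · positivity
      · exact le_rfl
    · rw [Finset.sum_ite_mem, Finset.univ_inter, Finset.sum_const, nsmul_eq_mul]
      field_simp⟩

/-- The behavior policy: in every state, uniform on `{e_1, …, e_d, 0}`. -/
def behavior (d H : ℕ) : Policy HState (HAction d) H := fun _ _ => probeDist d

/-- The law of the offline dataset of size `K` collected in `M_ξ`. -/
def hardLaw (d H K : ℕ) (ρ : ℝ) (ξ : Fin H → Fin d → ℤˣ) :
    Measure (Dataset HState (HAction d) H K) :=
  (hardInstance d H K ρ ξ).dataLaw (hardInit d) (behavior d H) K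

/-- The minimax risk `inf_{π̂} sup_ξ E_{D ∼ Q_ξ} SubOpt(M_ξ, π̂(D), s, ρ)` over all measurable maps
`π̂` from datasets to policies. -/
def minimaxRisk (d H K : ℕ) (ρ : ℝ) (s : HState) : ENNReal :=
  ⨅ πhat : {f : Dataset HState (HAction d) H K → Policy HState (HAction d) H // Measurable f},
    ⨆ ξ : Fin H → Fin d → ℤˣ,
      ∫⁻ D, ENNReal.ofReal ((hardInstance d H K ρ ξ).subOpt (πhat.1 D) s) ∂(hardLaw d H K ρ ξ)

end RobustRL

end

/-!
The theorem sandwiches both sides between multiples of `H * gap d K`, where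
`gap d K = d^{3/2} / √(2K)`.

*Values.* Rewards vanish in `x₂`, so the least favorable kernel sends the full mass `ρ` from `x₁`
to the absorbing state `x₂` in the first step (`worstKernel`, `robustValue_eq_worstValue`). Hence
the policy matching the signs of `ξ` is optimal, and the suboptimality of a policy is, up to the
factor `1 - ρ ≥ 1/4` on later steps, `gap / (2d)` times the sum over steps and coordinates of the
probability of playing the wrong bit (`le_subOpt`).

*Lower bound on the minimax risk* (`le_minimaxRisk`). By Assouad's method it is enough to compare
two instances differing in one sign. The nominal dynamics never leave the initial state, so the law
of a trajectory is a mixture of product laws, and step `h` is informative on the sign of coordinate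
`i` only if the pair `(x₁, e_i)` is observed, which has probability `1 / (d + 2)`; the means then
differ by `gap / d`. The likelihood ratio `L` of the `K` trajectories thus satisfies
`E L² ≤ exp 1 ≤ 3` (`lintegral_dataRatio_flipSign_sq_le`), and the elementary inequality
`min 1 L ≥ L - L² / 4` bounds the total error from below (`two_point_le`). Summing over `d H` signs
gives `minimaxRisk ≥ H gap / 64`.

*Upper bound on the uncertainty term* (`uncertaintyFn_le`). A Chernoff bound and a union bound show
that with probability `1 - δ` every one of the `d + 2` cells `(x₁, e_i)`, `(x₁, 0)`, `x₂` is seen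
at least `K / (2 (d + 2))` times at every step. Then `u_j² ≤ (12 d³ / K) uᵀ Λ_h u` for every
coordinate, so each diagonal entry of `Λ_h⁻¹` is at most `12 d³ / K`. As the features are
nonnegative with sum `1`, each step contributes at most `√(12 d³ / K) ≤ 5 gap`, under any policy
and any kernel.

Finally `Σ*_h = Λ_h` because the nominal kernel is deterministic, so all variances vanish.
-/

namespace RobustRL

/-! ### Product measures and Gaussian likelihood ratios -/

theorem lintegral_pi_prod_eq_prod {ι : Type*} [Fintype ι] {E : ι → Type*}
    [∀ i, MeasurableSpace (E i)] (μ : ∀ i, Measure (E i)) [∀ i, IsProbabilityMeasure (μ i)]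
    {f : ∀ i, E i → ENNReal} (hf : ∀ i, Measurable (f i)) :
    ∫⁻ x, ∏ i, f i (x i) ∂Measure.pi μ = ∏ i, ∫⁻ y, f i y ∂μ i := by
  have hind : iIndepFun (fun i (x : ∀ i, E i) => f i (x i)) (Measure.pi μ) :=
    iIndepFun_pi (fun i => (hf i).aemeasurable)
  rw [lintegral_prod_eq_prod_lintegral_of_indepFun Finset.univ _ hind
    (fun i => (hf i).comp (measurable_pi_apply i))]
  refine Finset.prod_congr rfl fun i _ => ?_
  exact (measurePreserving_eval μ i).lintegral_comp (hf i)

theorem pi_withDensity {ι : Type*} [Fintype ι] {E : ι → Type*}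
    [∀ i, MeasurableSpace (E i)] (μ : ∀ i, Measure (E i)) [∀ i, IsProbabilityMeasure (μ i)]
    {f : ∀ i, E i → ENNReal} (hf : ∀ i, Measurable (f i))
    [∀ i, SigmaFinite ((μ i).withDensity (f i))] :
    Measure.pi (fun i => (μ i).withDensity (f i)) =
      (Measure.pi μ).withDensity (fun x => ∏ i, f i (x i)) := by
  refine Measure.pi_eq fun s hs => ?_
  rw [withDensity_apply _ (MeasurableSet.univ_pi hs),
    ← lintegral_indicator (MeasurableSet.univ_pi hs)]
  have : ∀ x : ∀ i, E i, (Set.univ.pi s).indicator (fun x => ∏ i, f i (x i)) x =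
      ∏ i, (s i).indicator (f i) (x i) := by
    intro x
    by_cases hx : x ∈ Set.univ.pi s
    · rw [Set.indicator_of_mem hx]
      exact Finset.prod_congr rfl fun i _ => (Set.indicator_of_mem (hx i trivial) _).symm
    · rw [Set.indicator_of_notMem hx]
      simp only [Set.mem_pi, Set.mem_univ, true_imp_iff, not_forall] at hx
      obtain ⟨i, hi⟩ := hx
      exact (Finset.prod_eq_zero (Finset.mem_univ i) (Set.indicator_of_notMem hi _)).symm
  simp_rw [this]
  rw [lintegral_pi_prod_eq_prod μ (fun i => (hf i).indicator (hs i))]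
  refine Finset.prod_congr rfl fun i _ => ?_
  rw [withDensity_apply _ (hs i), lintegral_indicator (hs i)]

/-- The likelihood ratio of `N(m', 1)` to `N(m, 1)` at `r`. -/
noncomputable def gaussRatio (m m' r : ℝ) : ENNReal :=
  ENNReal.ofReal (Real.exp ((m' - m) * r - (m' ^ 2 - m ^ 2) / 2))

theorem gaussianReal_withDensity_gaussRatio (m m' : ℝ) :
    (gaussianReal m 1).withDensity (gaussRatio m m') = gaussianReal m' 1 := by
  rw [gaussianReal_of_var_ne_zero _ one_ne_zero, gaussianReal_of_var_ne_zero _ one_ne_zero,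
    ← withDensity_mul _ (measurable_gaussianPDF _ _)
      (by unfold gaussRatio; fun_prop)]
  congr 1
  funext r
  simp only [Pi.mul_apply, gaussianPDF, gaussRatio, gaussianPDFReal]
  rw [← ENNReal.ofReal_mul (by positivity), mul_assoc, ← Real.exp_add]
  congr 3
  simp
  ring

/-- The second moment of the Gaussian likelihood ratio, i.e. one plus the `χ²`-divergence. -/
theorem lintegral_gaussRatio_sq (m m' : ℝ) :
    ∫⁻ r, gaussRatio m m' r ^ 2 ∂gaussianReal m 1 = ENNReal.ofReal (Real.exp ((m' - m) ^ 2)) := by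
  have h1 : ∀ r, gaussRatio m m' r ^ 2 =
      ENNReal.ofReal (Real.exp (-(m' ^ 2 - m ^ 2)) * Real.exp (2 * (m' - m) * r)) := by
    intro r
    rw [gaussRatio, ← ENNReal.ofReal_pow (Real.exp_nonneg _), ← Real.exp_nat_mul, ← Real.exp_add]
    congr 2
    push_cast
    ring
  simp_rw [h1]
  rw [← ofReal_integral_eq_lintegral_ofReal
    ((integrable_exp_mul_gaussianReal _).const_mul _) (ae_of_all _ fun r => by positivity)]
  congr 1
  rw [integral_const_mul]
  have h2 := congrFun (mgf_id_gaussianReal (μ := m) (v := 1)) (2 * (m' - m))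
  simp only [mgf, id] at h2
  rw [h2, ← Real.exp_add]
  congr 1
  simp
  ring

section Likelihood

variable {S A : Type} {n H : ℕ} [MeasurableSpace S] [MeasurableSpace A]

/-- The likelihood ratio of one observed step `(s, a, r)` when the mean reward changes from `R`
to `R'` and the dynamics stay the same. -/
noncomputable def stepRatio (R R' : S → A → ℝ) (y : S × A × ℝ) : ENNReal :=
  gaussRatio (R y.1 y.2.1) (R' y.1 y.2.1) y.2.2

/-- The law of an observed step with given state and action and reward mean `m`. -/
noncomputable def stepLaw (s : S) (a : A) (m : ℝ) : Measure (S × A × ℝ) :=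
  (Measure.dirac s).prod ((Measure.dirac a).prod (gaussianReal m 1))

instance (s : S) (a : A) (m : ℝ) : IsProbabilityMeasure (stepLaw s a m) := by
  unfold stepLaw; infer_instance

theorem stepLaw_eq_map (s : S) (a : A) (m : ℝ) :
    stepLaw s a m = (gaussianReal m 1).map (fun r => (s, a, r)) := by
  rw [stepLaw, Measure.dirac_prod, Measure.dirac_prod, Measure.map_map (by fun_prop) (by fun_prop)]
  rfl

theorem lintegral_stepLaw (s : S) (a : A) (m : ℝ) {g : S × A × ℝ → ENNReal} (hg : Measurable g) :
    ∫⁻ y, g y ∂stepLaw s a m = ∫⁻ r, g (s, a, r) ∂gaussianReal m 1 := by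
  rw [stepLaw_eq_map, lintegral_map hg (by fun_prop)]

variable [Fintype S] [Fintype A]

theorem trajLaw_eq (M : LinearDRMDP S A n H) (init : S → ℝ) (π : Policy S A H) :
    M.trajLaw init π = ∑ x : Fin H → S × A, ENNReal.ofReal (pathProb init M.nominal π x) •
      Measure.pi (fun h => stepLaw (x h).1 (x h).2 (M.reward h (x h).1 (x h).2)) := rfl

theorem lintegral_trajLaw (M : LinearDRMDP S A n H) (init : S → ℝ) (π : Policy S A H)
    {f : Fin H → S × A × ℝ → ENNReal} (hf : ∀ h, Measurable (f h)) :
    ∫⁻ y, ∏ h, f h (y h) ∂M.trajLaw init π =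
      ∑ x : Fin H → S × A, ENNReal.ofReal (pathProb init M.nominal π x) *
        ∏ h, ∫⁻ y, f h y ∂stepLaw (x h).1 (x h).2 (M.reward h (x h).1 (x h).2) := by
  rw [trajLaw_eq, lintegral_finsetSum_measure]
  refine Finset.sum_congr rfl fun x _ => ?_
  rw [lintegral_smul_measure, lintegral_pi_prod_eq_prod _ hf, smul_eq_mul]

variable [MeasurableSingletonClass S] [MeasurableSingletonClass A]

theorem measurable_stepRatio (R R' : S → A → ℝ) : Measurable (stepRatio R R') := by
  have h : ∀ R : S → A → ℝ, Measurable (fun y : S × A × ℝ => R y.1 y.2.1) := fun R =>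
    (Measurable.of_discrete (f := fun z : S × A => R z.1 z.2)).comp
      (g := fun z : S × A => R z.1 z.2) (f := fun y : S × A × ℝ => (y.1, y.2.1)) (by fun_prop)
  have h1 := h R
  have h2 := h R'
  unfold stepRatio gaussRatio
  fun_prop

theorem stepLaw_withDensity_stepRatio (R R' : S → A → ℝ) (s : S) (a : A) :
    (stepLaw s a (R s a)).withDensity (stepRatio R R') = stepLaw s a (R' s a) := by
  ext t ht
  rw [withDensity_apply _ ht, ← lintegral_indicator ht,
    lintegral_stepLaw _ _ _ ((measurable_stepRatio R R').indicator ht), stepLaw_eq_map,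
    Measure.map_apply (by fun_prop) ht, ← gaussianReal_withDensity_gaussRatio (R s a) (R' s a),
    withDensity_apply _ (by exact (by fun_prop : Measurable fun r : ℝ => (s, a, r)) ht),
    ← lintegral_indicator (by exact (by fun_prop : Measurable fun r : ℝ => (s, a, r)) ht)]
  rfl

/-- The likelihood ratio of a trajectory between two instances with the same dynamics. -/
noncomputable def trajRatio (M M' : LinearDRMDP S A n H) (y : Fin H → S × A × ℝ) : ENNReal :=
  ∏ h, stepRatio (M.reward h) (M'.reward h) (y h)

theorem measurable_trajRatio (M M' : LinearDRMDP S A n H) : Measurable (trajRatio M M') := by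
  have := fun h => measurable_stepRatio (M.reward h) (M'.reward h)
  unfold trajRatio
  fun_prop

theorem trajLaw_withDensity_trajRatio (M M' : LinearDRMDP S A n H)
    (hnom : M'.nominal = M.nominal) (init : S → ℝ) (π : Policy S A H) :
    (M.trajLaw init π).withDensity (trajRatio M M') = M'.trajLaw init π := by
  rw [trajLaw_eq, trajLaw_eq, hnom, ← Measure.sum_fintype, ← Measure.sum_fintype,
    withDensity_sum]
  congr 1
  funext x
  rw [withDensity_smul_measure]
  congr 1
  have hd := fun h => stepLaw_withDensity_stepRatio (M.reward h) (M'.reward h) (x h).1 (x h).2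
  have : ∀ h, SigmaFinite ((stepLaw (x h).1 (x h).2
      (M.reward h (x h).1 (x h).2)).withDensity (stepRatio (M.reward h) (M'.reward h))) := by
    intro h; rw [hd h]; infer_instance
  have key := pi_withDensity
    (fun h => stepLaw (x h).1 (x h).2 (M.reward h (x h).1 (x h).2))
    (fun h => measurable_stepRatio (M.reward h) (M'.reward h))
  simp_rw [hd] at key
  exact key.symm

theorem lintegral_trajRatio_sq (M M' : LinearDRMDP S A n H) (init : S → ℝ) (π : Policy S A H) :
    ∫⁻ y, trajRatio M M' y ^ 2 ∂M.trajLaw init π =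
      ∑ x : Fin H → S × A, ENNReal.ofReal (pathProb init M.nominal π x) *
        ENNReal.ofReal (Real.exp
          (∑ h, (M'.reward h (x h).1 (x h).2 - M.reward h (x h).1 (x h).2) ^ 2)) := by
  set f : Fin H → S × A × ℝ → ENNReal := fun h z => stepRatio (M.reward h) (M'.reward h) z ^ 2
    with hf
  have h2 : ∀ h, Measurable (f h) := fun h =>
    (measurable_stepRatio (M.reward h) (M'.reward h)).pow_const 2
  have h1 : ∀ y : Fin H → S × A × ℝ, trajRatio M M' y ^ 2 = ∏ h, f h (y h) := fun y =>
    (Finset.prod_pow _ _ _).symm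
  rw [lintegral_congr h1, lintegral_trajLaw M init π h2]
  refine Finset.sum_congr rfl fun x _ => ?_
  rw [Real.exp_sum, ENNReal.ofReal_prod_of_nonneg fun _ _ => Real.exp_nonneg _]
  congr 1
  refine Finset.prod_congr rfl fun h _ => ?_
  rw [lintegral_stepLaw _ _ _ (h2 h), ← lintegral_gaussRatio_sq]
  rfl

end Likelihood

/-- **Two-point bound.** If `L` is a likelihood ratio with `E L² ≤ 3`, no `[0,1]`-valued statistic
can have small error under both laws. Pointwise, `g + (1 - g) L ≥ min 1 L ≥ L - L² / 4`. -/
theorem two_point_le {Ω : Type*} [MeasurableSpace Ω] (P Q : Measure Ω) {L : Ω → ENNReal}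
    (hL : Measurable L) (hQ : Q = P.withDensity L) (hQu : Q Set.univ = 1)
    (hL2 : ∫⁻ ω, L ω ^ 2 ∂P ≤ 3) {g : Ω → ℝ} (hg : Measurable g) (hg0 : ∀ ω, 0 ≤ g ω)
    (hg1 : ∀ ω, g ω ≤ 1) :
    ENNReal.ofReal (1 / 4) ≤
      ∫⁻ ω, ENNReal.ofReal (g ω) ∂P + ∫⁻ ω, ENNReal.ofReal (1 - g ω) ∂Q := by
  have hL1 : ∫⁻ ω, L ω ∂P = 1 := by
    rw [← setLIntegral_univ, ← withDensity_apply _ MeasurableSet.univ, ← hQ, hQu]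
  have hpt : ∀ ω, L ω ≤ ENNReal.ofReal (g ω) + L ω * ENNReal.ofReal (1 - g ω) +
      ENNReal.ofReal (1 / 4) * L ω ^ 2 := by
    intro ω
    by_cases htop : L ω = ⊤
    · rw [htop]
      simp [ENNReal.mul_top]
    · obtain ⟨l, hl0, hl⟩ : ∃ l : ℝ, 0 ≤ l ∧ L ω = ENNReal.ofReal l :=
        ⟨(L ω).toReal, ENNReal.toReal_nonneg, (ENNReal.ofReal_toReal htop).symm⟩
      have h0 := hg0 ω
      have h1 := sub_nonneg.2 (hg1 ω)
      rw [hl, ← ENNReal.ofReal_pow hl0, ← ENNReal.ofReal_mul hl0,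
        ← ENNReal.ofReal_mul (by norm_num), ← ENNReal.ofReal_add h0 (by positivity),
        ← ENNReal.ofReal_add (by positivity) (by positivity)]
      refine ENNReal.ofReal_le_ofReal ?_
      rcases le_total l 1 with hl1 | hl1
      · nlinarith [mul_nonneg h0 (sub_nonneg.2 hl1), sq_nonneg l]
      · nlinarith [mul_nonneg h1 (sub_nonneg.2 hl1), sq_nonneg (l / 2 - 1)]
  have hgP : Measurable fun ω => ENNReal.ofReal (g ω) := by fun_prop
  have hgPQ : Measurable fun ω => ENNReal.ofReal (g ω) + L ω * ENNReal.ofReal (1 - g ω) := by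
    fun_prop
  have hle := lintegral_mono (μ := P) hpt
  rw [hL1, lintegral_add_left hgPQ, lintegral_add_left hgP,
    lintegral_const_mul _ (hL.pow_const 2)] at hle
  rw [hQ, lintegral_withDensity_eq_lintegral_mul _ hL (by fun_prop)]
  simp only [Pi.mul_apply]
  have h34 : ENNReal.ofReal (1 / 4) * ∫⁻ ω, L ω ^ 2 ∂P ≤ ENNReal.ofReal (3 / 4) := by
    calc _ ≤ ENNReal.ofReal (1 / 4) * 3 := by gcongr
      _ = ENNReal.ofReal (1 / 4) * ENNReal.ofReal 3 := by norm_num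
      _ = ENNReal.ofReal (3 / 4) := by
        rw [← ENNReal.ofReal_mul (by norm_num)]; norm_num
  have hsum : ENNReal.ofReal (1 / 4) + ENNReal.ofReal (3 / 4) = 1 := by
    rw [← ENNReal.ofReal_add (by norm_num) (by norm_num)]; norm_num
  refine (ENNReal.add_le_add_iff_right (a := ENNReal.ofReal (3 / 4)) ENNReal.ofReal_ne_top).1 ?_
  rw [hsum]
  exact hle.trans (add_le_add_right h34 _)

/-- **Chernoff bound for i.i.d. counts.** If a sample lies in `B` with probability at least `p`,
the number of hits among `K` samples is below `p K / 2` with probability at most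
`exp (-p K / 8)`. -/
theorem chernoff_count {Ω : Type*} [MeasurableSpace Ω] (Q : Measure Ω) [IsProbabilityMeasure Q]
    (K : ℕ) {B : Set Ω} [DecidablePred (· ∈ B)] (hB : MeasurableSet B) {p : ℝ} (hp : 0 ≤ p)
    (hQB : ENNReal.ofReal p ≤ Q B) :
    Measure.pi (fun _ : Fin K => Q) {D | ∑ τ, (if D τ ∈ B then (1 : ℝ) else 0) < p * K / 2} ≤
      ENNReal.ofReal (Real.exp (-(p * K / 8))) := by
  have hmeas : Measurable fun ω => (if ω ∈ B then (1 : ℝ) else 0) :=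
    Measurable.ite hB measurable_const measurable_const
  set f : Ω → ENNReal := fun ω => ENNReal.ofReal (Real.exp (-(if ω ∈ B then (1 : ℝ) else 0)))
    with hf
  have hfm : Measurable f := by fun_prop
  have he : Real.exp (-1) ≤ 3 / 8 := by
    have := Real.exp_neg_one_lt_d9; linarith
  -- Exponential Markov with parameter `1`: `1 - exp (-1) ≥ 5 / 8`, and `5 / 8 - 1 / 2 = 1 / 8`.
  have hone : ∫⁻ ω, f ω ∂Q ≤ ENNReal.ofReal (Real.exp (-(5 / 8 * p))) := by
    have hpt : ∀ ω, f ω + ENNReal.ofReal (5 / 8) * B.indicator 1 ω ≤ 1 := by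
      intro ω
      by_cases h : ω ∈ B
      · simp only [hf, h, if_true, Set.indicator_of_mem, Pi.one_apply, mul_one]
        rw [← ENNReal.ofReal_add (by positivity) (by norm_num), ← ENNReal.ofReal_one]
        exact ENNReal.ofReal_le_ofReal (by linarith)
      · simp [hf, h]
    have hle := lintegral_mono (μ := Q) hpt
    rw [lintegral_add_left hfm, lintegral_const_mul _ (measurable_one.indicator hB),
      lintegral_indicator_one hB, lintegral_one, measure_univ] at hle
    have hp1 : p ≤ 1 := by
      have := hQB.trans prob_le_one
      rwa [ENNReal.ofReal_le_one] at this
    have h2 : ∫⁻ ω, f ω ∂Q + ENNReal.ofReal (5 / 8 * p) ≤ 1 := by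
      refine le_trans ?_ hle
      rw [ENNReal.ofReal_mul (by norm_num)]
      gcongr
    calc ∫⁻ ω, f ω ∂Q ≤ 1 - ENNReal.ofReal (5 / 8 * p) :=
          ENNReal.le_sub_of_add_le_right ENNReal.ofReal_ne_top h2
      _ = ENNReal.ofReal (1 - 5 / 8 * p) := by
          rw [ENNReal.ofReal_sub _ (by positivity), ENNReal.ofReal_one]
      _ ≤ _ := ENNReal.ofReal_le_ofReal (by
          have := Real.add_one_le_exp (-(5 / 8 * p)); linarith)
  set F : (Fin K → Ω) → ENNReal := fun D => ∏ τ, f (D τ) with hF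
  have hFm : Measurable F := by fun_prop
  have hFint : ∫⁻ D, F D ∂Measure.pi (fun _ : Fin K => Q) ≤
      ENNReal.ofReal (Real.exp (-(5 / 8 * p * K))) := by
    rw [hF, lintegral_pi_prod_eq_prod (fun _ : Fin K => Q) (fun _ => hfm), Finset.prod_const,
      Finset.card_univ, Fintype.card_fin]
    calc (∫⁻ ω, f ω ∂Q) ^ K ≤ ENNReal.ofReal (Real.exp (-(5 / 8 * p))) ^ K := by gcongr
      _ = _ := by
        rw [← ENNReal.ofReal_pow (Real.exp_nonneg _), ← Real.exp_nat_mul]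
        congr 2; ring
  have hsub : {D : Fin K → Ω | ∑ τ, (if D τ ∈ B then (1 : ℝ) else 0) < p * K / 2} ⊆
      {D | ENNReal.ofReal (Real.exp (-(p * K / 2))) ≤ F D} := by
    intro D hD
    simp only [Set.mem_ofPred_eq, hF, hf] at hD ⊢
    rw [← ENNReal.ofReal_prod_of_nonneg fun _ _ => Real.exp_nonneg _, ← Real.exp_sum,
      Finset.sum_neg_distrib]
    exact ENNReal.ofReal_le_ofReal (Real.exp_le_exp.2 (by linarith))
  refine (measure_mono hsub).trans ?_
  refine (meas_ge_le_lintegral_div hFm.aemeasurable (by positivity) ENNReal.ofReal_ne_top).trans ?_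
  calc _ ≤ ENNReal.ofReal (Real.exp (-(5 / 8 * p * K))) /
        ENNReal.ofReal (Real.exp (-(p * K / 2))) := by gcongr
    _ = _ := by
      rw [← ENNReal.ofReal_div_of_pos (Real.exp_pos _), ← Real.exp_sub]
      congr 2; ring

/-! ### Expected sums under stochastic kernels -/

section ExpectedSum

variable {S A : Type} {n H : ℕ} [Fintype S]

theorem LinearDRMDP.IsLinear.mem_stdSimplex {M : LinearDRMDP S A n H} (hM : M.IsLinear)
    {P : Transition S A H} (hP : P ∈ M.uncertaintySet) (h : Fin H) (s : S) (a : A) :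
    P h s a ∈ stdSimplex ℝ S := by
  obtain ⟨ν, hν, hPν⟩ := hP h s a
  refine ⟨fun s' => ?_, ?_⟩
  · rw [hPν]
    exact Finset.sum_nonneg fun i _ => mul_nonneg (hM.1 s a i) ((hν i).1.1 s')
  · simp_rw [hPν]
    rw [Finset.sum_comm]
    simp_rw [← Finset.mul_sum, (hν _).1.2, mul_one]
    exact hM.2.1 s a

variable [Fintype A]

theorem expectedSum_of_lt (f : Fin H → S → A → ℝ) (P : Transition S A H) (π : Policy S A H)
    {h : ℕ} (hh : h < H) (s : S) :
    expectedSum f P π h s = ∑ a, (π ⟨h, hh⟩ s).1 a *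
      (f ⟨h, hh⟩ s a + ∑ s', P ⟨h, hh⟩ s a s' * expectedSum f P π (h + 1) s') := by
  rw [expectedSum, dif_pos hh]

theorem expectedSum_of_ge (f : Fin H → S → A → ℝ) (P : Transition S A H) (π : Policy S A H)
    {h : ℕ} (hh : H ≤ h) (s : S) : expectedSum f P π h s = 0 := by
  rw [expectedSum, dif_neg (by omega)]

theorem expectedSum_nonneg {f : Fin H → S → A → ℝ} {P : Transition S A H} (π : Policy S A H)
    (hf : ∀ h s a, 0 ≤ f h s a) (hP : ∀ h s a s', 0 ≤ P h s a s') (h : ℕ) (s : S) :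
    0 ≤ expectedSum f P π h s := by
  induction k : H - h generalizing h s with
  | zero => rw [expectedSum_of_ge _ _ _ (by omega)]
  | succ k ih =>
    rw [expectedSum_of_lt _ _ _ (by omega)]
    exact Finset.sum_nonneg fun a _ => mul_nonneg ((π _ s).2.1 a) (add_nonneg (hf _ _ _)
      (Finset.sum_nonneg fun s' _ => mul_nonneg (hP _ _ _ _) (ih (h + 1) s' (by omega))))

theorem expectedSum_le {f : Fin H → S → A → ℝ} {P : Transition S A H} (π : Policy S A H) {B : ℝ}
    (hf : ∀ h s a, f h s a ≤ B) (hP : ∀ h s a, P h s a ∈ stdSimplex ℝ S) (h : ℕ) (s : S) :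
    expectedSum f P π h s ≤ ((H - h : ℕ) : ℝ) * B := by
  induction hk : H - h generalizing h s with
  | zero => rw [expectedSum_of_ge _ _ _ (by omega)]; simp
  | succ k ih =>
    have hh : h < H := by omega
    rw [expectedSum_of_lt _ _ _ hh]
    calc _ ≤ ∑ a, (π ⟨h, hh⟩ s).1 a * (B + k * B) := by
          refine Finset.sum_le_sum fun a _ => mul_le_mul_of_nonneg_left
            (add_le_add (hf _ _ _) ?_) ((π _ s).2.1 a)
          calc _ ≤ ∑ s', P ⟨h, hh⟩ s a s' * (k * B) := Finset.sum_le_sum fun s' _ =>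
                mul_le_mul_of_nonneg_left (ih (h + 1) s' (by omega)) ((hP _ _ _).1 s')
            _ = k * B := by rw [← Finset.sum_mul, (hP _ _ _).2, one_mul]
      _ = _ := by
        rw [← Finset.sum_mul, (π ⟨h, hh⟩ s).2.2]
        push_cast
        ring

end ExpectedSum

/-! ### Features, rewards and kernels of the hard instances -/

theorem bit_nonneg (b : Bool) : 0 ≤ bit b := by unfold bit; split_ifs <;> norm_num

theorem bit_le_one (b : Bool) : bit b ≤ 1 := by unfold bit; split_ifs <;> norm_num

theorem gap_nonneg (d K : ℕ) : 0 ≤ gap d K := by unfold gap; positivity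

theorem sq_gap (d K : ℕ) : gap d K ^ 2 = (d : ℝ) ^ 3 / (2 * K) := by
  rw [gap, div_pow, Real.sq_sqrt (by positivity), ← Real.rpow_natCast, ← Real.rpow_mul (by positivity)]
  norm_num

theorem sum_bit_div_le_one (d : ℕ) (a : HAction d) : ∑ i, bit (a i) / d ≤ 1 := by
  rw [← Finset.sum_div]
  refine div_le_one_of_le₀ ?_ (by positivity)
  calc ∑ i, bit (a i) ≤ ∑ _i : Fin d, (1 : ℝ) := Finset.sum_le_sum fun i _ => bit_le_one _
    _ = d := by simp

theorem sum_hardFeature_zero_mul (d : ℕ) (a : HAction d) (u : Fin (d + 2) → ℝ) :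
    ∑ i, hardFeature d 0 a i * u i = ∑ i : Fin d, bit (a i) / d * u i.castSucc.castSucc +
      (1 - ∑ i, bit (a i) / d) * u (Fin.last d).castSucc := by
  simp [hardFeature, Fin.sum_univ_castSucc]

theorem sum_hardFeature_one_mul (d : ℕ) (a : HAction d) (u : Fin (d + 2) → ℝ) :
    ∑ i, hardFeature d 1 a i * u i = u (Fin.last (d + 1)) := by
  simp [hardFeature, Fin.sum_univ_castSucc]

theorem hardFeature_nonneg (d : ℕ) (s : HState) (a : HAction d) (i : Fin (d + 2)) :
    0 ≤ hardFeature d s a i := by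
  have h1 := sum_bit_div_le_one d a
  unfold hardFeature
  split_ifs
  · refine Fin.lastCases (by simp) (fun j => Fin.lastCases ?_ (fun i => ?_) j) i
    · simpa using h1
    · simpa using div_nonneg (bit_nonneg (a i)) (Nat.cast_nonneg d)
  · refine Fin.lastCases (by simp) (fun j => by simp) i

theorem sum_hardFeature (d : ℕ) (s : HState) (a : HAction d) : ∑ i, hardFeature d s a i = 1 := by
  match s with
  | 0 => simpa using sum_hardFeature_zero_mul d a 1
  | 1 => simpa using sum_hardFeature_one_mul d a 1

section HardInstance

variable {d H K : ℕ} {ρ : ℝ}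

theorem hardInstance_reward_zero (ξ : Fin H → Fin d → ℤˣ) (h : Fin H) (a : HAction d) :
    (hardInstance d H K ρ ξ).reward h 0 a =
      gap d K / 2 * (1 + ∑ i, bit (a i) / d * ((ξ h i : ℤ) : ℝ)) := by
  have : (hardInstance d H K ρ ξ).reward h 0 a = _ := sum_hardFeature_zero_mul d a _
  rw [this]
  simp only [hardInstance, Fin.snoc_castSucc, Fin.snoc_last]
  have h2 : ∀ i, bit (a i) / d * (gap d K * ((((ξ h i : ℤ) : ℝ) + 1) / 2)) =
      gap d K / 2 * (bit (a i) / d * ((ξ h i : ℤ) : ℝ)) + gap d K / 2 * (bit (a i) / d) := by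
    intro i; ring
  simp_rw [h2, Finset.sum_add_distrib, ← Finset.mul_sum]
  ring

theorem hardInstance_reward_one (ξ : Fin H → Fin d → ℤˣ) (h : Fin H) (a : HAction d) :
    (hardInstance d H K ρ ξ).reward h 1 a = 0 := by
  have : (hardInstance d H K ρ ξ).reward h 1 a = _ := sum_hardFeature_one_mul d a _
  rw [this]
  simp [hardInstance]

theorem hardInstance_theta_mem (ξ : Fin H → Fin d → ℤˣ) (h : Fin H) (i : Fin (d + 2)) :
    0 ≤ (hardInstance d H K ρ ξ).θ h i ∧ (hardInstance d H K ρ ξ).θ h i ≤ gap d K := by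
  have hg := gap_nonneg d K
  simp only [hardInstance]
  refine Fin.lastCases ?_ (fun j => Fin.lastCases ?_ (fun i => ?_) j) i
  · simpa using hg
  · simp only [Fin.snoc_castSucc, Fin.snoc_last]
    constructor <;> linarith
  · simp only [Fin.snoc_castSucc]
    rcases Int.units_eq_one_or (ξ h i) with h1 | h1 <;> simp [h1, hg]

theorem hardInstance_reward_mem (ξ : Fin H → Fin d → ℤˣ) (h : Fin H) (s : HState)
    (a : HAction d) : 0 ≤ (hardInstance d H K ρ ξ).reward h s a ∧
      (hardInstance d H K ρ ξ).reward h s a ≤ gap d K := by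
  have ht := hardInstance_theta_mem (K := K) (ρ := ρ) ξ h
  refine ⟨Finset.sum_nonneg fun i _ => mul_nonneg (hardFeature_nonneg d s a i) (ht i).1, ?_⟩
  calc _ ≤ ∑ i, hardFeature d s a i * gap d K := Finset.sum_le_sum fun i _ =>
        mul_le_mul_of_nonneg_left (ht i).2 (hardFeature_nonneg d s a i)
    _ = gap d K := by rw [← Finset.sum_mul, sum_hardFeature, one_mul]

theorem hardInstance_isLinear (hρ : 0 ≤ ρ) (hgap : gap d K ≤ 1) (ξ : Fin H → Fin d → ℤˣ) :
    (hardInstance d H K ρ ξ).IsLinear := by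
  refine ⟨hardFeature_nonneg d, sum_hardFeature d, fun h i => ?_, fun h => ?_, fun h s a => ?_,
    fun h => ?_⟩
  · simp only [hardInstance]
    refine Fin.lastCases ?_ (fun j => ?_) i
    · simpa using single_mem_stdSimplex ℝ (1 : HState)
    · simpa using single_mem_stdSimplex ℝ (0 : HState)
  · refine Real.sqrt_le_sqrt ?_
    calc _ ≤ ∑ _i : Fin (d + 2), (1 : ℝ) := Finset.sum_le_sum fun i _ => by
          have := hardInstance_theta_mem (K := K) (ρ := ρ) ξ h i
          exact pow_le_one₀ this.1 (this.2.trans hgap)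
      _ = _ := by simp
  · have := hardInstance_reward_mem (K := K) (ρ := ρ) ξ h s a
    exact ⟨this.1, this.2.trans hgap⟩
  · simp only [hardInstance]
    split_ifs
    exacts [hρ, le_rfl]

theorem hardInstance_nominal (ξ : Fin H → Fin d → ℤˣ) (h : Fin H) (s : HState) (a : HAction d) :
    (hardInstance d H K ρ ξ).nominal h s a = Pi.single s 1 := by
  funext s'
  match s with
  | 0 =>
    have : (hardInstance d H K ρ ξ).nominal h 0 a s' = _ := sum_hardFeature_zero_mul d a _
    rw [this]
    simp only [hardInstance, Fin.snoc_castSucc, ← Finset.sum_mul]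
    ring
  | 1 =>
    have : (hardInstance d H K ρ ξ).nominal h 1 a s' = _ := sum_hardFeature_one_mul d a _
    rw [this]
    simp [hardInstance]

/-- The least favorable kernel: from `x₁` it moves the whole radius of mass to the absorbing
rewardless state `x₂`. -/
noncomputable def worstKernel (M : LinearDRMDP HState (HAction d) (d + 2) H) :
    Transition HState (HAction d) H :=
  fun h s _ => if s = 0 then ![1 - M.radius h, M.radius h] else ![0, 1]

theorem tvDist_pair {x y x' y' : ℝ} (h : x + y = 1) (h' : x' + y' = 1) :
    tvDist (![x, y] : HState → ℝ) ![x', y'] = |x - x'| := by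
  have : y - y' = -(x - x') := by linarith
  simp only [tvDist, Fin.sum_univ_two, Matrix.cons_val_zero, Matrix.cons_val_one, this, abs_neg]
  ring

theorem hardInstance_radius_mem (hρ : 0 ≤ ρ) (hρ1 : ρ ≤ 1) (ξ : Fin H → Fin d → ℤˣ) (h : Fin H) :
    0 ≤ (hardInstance d H K ρ ξ).radius h ∧ (hardInstance d H K ρ ξ).radius h ≤ 1 := by
  simp only [hardInstance]
  split_ifs
  · exact ⟨hρ, hρ1⟩
  · norm_num

theorem single_zero_eq : (Pi.single 0 1 : HState → ℝ) = ![1, 0] := by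
  funext i; fin_cases i <;> simp

theorem single_one_eq : (Pi.single 1 1 : HState → ℝ) = ![0, 1] := by
  funext i; fin_cases i <;> simp

/-- The first `d + 1` factors are moved by the full radius towards `x₂`; the last one already
equals `δ_{x₂}`. -/
theorem worstKernel_mem (hρ : 0 ≤ ρ) (hρ1 : ρ ≤ 1) (ξ : Fin H → Fin d → ℤˣ) :
    worstKernel (hardInstance d H K ρ ξ) ∈ (hardInstance d H K ρ ξ).uncertaintySet := by
  intro h s a
  obtain ⟨hr0, hr1⟩ := hardInstance_radius_mem (K := K) hρ hρ1 ξ h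
  set r := (hardInstance d H K ρ ξ).radius h with hr
  refine ⟨Fin.snoc (fun _ : Fin (d + 1) => (![1 - r, r] : HState → ℝ)) ![0, 1], fun i => ?_,
    fun s' => ?_⟩
  · refine Fin.lastCases ?_ (fun j => ?_) i
    · simp only [LinearDRMDP.factorSet, Fin.snoc_last, hardInstance, Set.mem_ofPred_eq]
      rw [single_one_eq, tvDist_pair (by norm_num) (by norm_num), ← single_one_eq]
      exact ⟨single_mem_stdSimplex ℝ _, by simpa [hr, hardInstance] using hr0⟩
    · simp only [LinearDRMDP.factorSet, Fin.snoc_castSucc, hardInstance, Set.mem_ofPred_eq]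
      rw [single_zero_eq, tvDist_pair (by ring) (by norm_num)]
      refine ⟨⟨fun s => ?_, by simp⟩, ?_⟩
      · fin_cases s
        · simpa using hr1
        · simpa using hr0
      · rw [show 1 - r - 1 = -r by ring, abs_neg, abs_of_nonneg hr0]
        exact le_rfl
  · match s with
    | 0 =>
      simp only [worstKernel, if_true]
      refine Eq.trans ?_ (sum_hardFeature_zero_mul d a _).symm
      simp only [Fin.snoc_castSucc, ← Finset.sum_mul, ← hr]
      ring
    | 1 =>
      simp only [worstKernel, one_ne_zero, if_false]
      refine Eq.trans ?_ (sum_hardFeature_one_mul d a _).symm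
      simp

theorem one_sub_radius_le (ξ : Fin H → Fin d → ℤˣ) {P : Transition HState (HAction d) H}
    (hP : P ∈ (hardInstance d H K ρ ξ).uncertaintySet) (h : Fin H) (a : HAction d) :
    1 - (hardInstance d H K ρ ξ).radius h ≤ P h 0 a 0 := by
  obtain ⟨ν, hν, hPν⟩ := hP h 0 a
  have key : ∀ j : Fin (d + 1), 1 - (hardInstance d H K ρ ξ).radius h ≤ ν j.castSucc 0 := by
    intro j
    obtain ⟨⟨_, h1⟩, h2⟩ := hν j.castSucc
    rw [Fin.sum_univ_two] at h1
    have h3 : ν j.castSucc = ![ν j.castSucc 0, ν j.castSucc 1] := by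
      funext s; fin_cases s <;> simp
    have h4 : (hardInstance d H K ρ ξ).μ h j.castSucc = ![1, 0] := by
      simp [hardInstance, single_zero_eq]
    rw [h3, h4, tvDist_pair h1 (by norm_num)] at h2
    linarith [(abs_le.1 h2).1]
  rw [hPν]
  have : ∑ i, (hardInstance d H K ρ ξ).φ 0 a i * ν i 0 = _ :=
    sum_hardFeature_zero_mul d a fun i => ν i 0
  rw [this]
  set c := 1 - (hardInstance d H K ρ ξ).radius h
  calc c = ∑ i, bit (a i) / d * c + (1 - ∑ i, bit (a i) / d) * c := by
        rw [← Finset.sum_mul]; ring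
    _ ≤ _ := by
        refine add_le_add (Finset.sum_le_sum fun i _ => mul_le_mul_of_nonneg_left (key _)
          (div_nonneg (bit_nonneg _) (Nat.cast_nonneg _)))
          (mul_le_mul_of_nonneg_left (key _) (sub_nonneg.2 (sum_bit_div_le_one d a)))

/-! ### Robust values of the hard instances -/

/-- The probability that `π` plays an action with `a_i = 1` in state `x₁` at step `h`. -/
noncomputable def coordProb (π : Policy HState (HAction d) H) (h : Fin H) (i : Fin d) : ℝ :=
  ∑ a, (π h 0).1 a * bit (a i)

theorem coordProb_nonneg (π : Policy HState (HAction d) H) (h : Fin H) (i : Fin d) :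
    0 ≤ coordProb π h i :=
  Finset.sum_nonneg fun a _ => mul_nonneg ((π h 0).2.1 a) (bit_nonneg _)

theorem coordProb_le_one (π : Policy HState (HAction d) H) (h : Fin H) (i : Fin d) :
    coordProb π h i ≤ 1 := by
  rw [← (π h 0).2.2]
  exact Finset.sum_le_sum fun a _ => mul_le_of_le_one_right ((π h 0).2.1 a) (bit_le_one _)

/-- The loss in coordinate `i` of playing `a_i = 1` with probability `p` when the sign of the
coordinate is `x`. -/
noncomputable def coordLoss (x : ℤˣ) (p : ℝ) : ℝ := if x = 1 then 1 - p else p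

theorem coordLoss_nonneg {x : ℤˣ} {p : ℝ} (h0 : 0 ≤ p) (h1 : p ≤ 1) : 0 ≤ coordLoss x p := by
  unfold coordLoss; split_ifs <;> linarith

/-- The policy that plays `a_i = 1` exactly in the coordinates with sign `+1`. -/
noncomputable def oraclePolicy (ξ : Fin H → Fin d → ℤˣ) : Policy HState (HAction d) H :=
  fun h _ => ⟨Pi.single (fun i => decide (ξ h i = 1)) 1, single_mem_stdSimplex ℝ _⟩

theorem sum_policy_mul_reward (ξ : Fin H → Fin d → ℤˣ) (π : Policy HState (HAction d) H)
    (h : Fin H) : ∑ a, (π h 0).1 a * (hardInstance d H K ρ ξ).reward h 0 a =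
      gap d K / 2 * (1 + ∑ i, coordProb π h i / d * ((ξ h i : ℤ) : ℝ)) := by
  simp_rw [hardInstance_reward_zero, mul_add, mul_one, Finset.sum_add_distrib, ← Finset.sum_mul,
    (π h 0).2.2, one_mul]
  congr 1
  simp_rw [coordProb, Finset.sum_div, Finset.sum_mul, Finset.mul_sum]
  rw [Finset.sum_comm]
  refine Finset.sum_congr rfl fun i _ => Finset.sum_congr rfl fun a _ => ?_
  ring

theorem coordProb_oraclePolicy (ξ : Fin H → Fin d → ℤˣ) (h : Fin H) (i : Fin d) :
    coordProb (oraclePolicy ξ) h i = if ξ h i = 1 then 1 else 0 := by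
  rw [coordProb, Finset.sum_eq_single (fun i => decide (ξ h i = 1))]
  · simp [oraclePolicy, bit]
  · intro a _ ha
    simp [oraclePolicy, ha]
  · simp

/-- The one-step regret in `x₁` is linear in the probabilities of playing the wrong bits. -/
theorem step_regret (ξ : Fin H → Fin d → ℤˣ) (π : Policy HState (HAction d) H) (h : Fin H) :
    ∑ a, (oraclePolicy ξ h 0).1 a * (hardInstance d H K ρ ξ).reward h 0 a -
      ∑ a, (π h 0).1 a * (hardInstance d H K ρ ξ).reward h 0 a =
      gap d K / (2 * d) * ∑ i, coordLoss (ξ h i) (coordProb π h i) := by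
  rw [sum_policy_mul_reward, sum_policy_mul_reward]
  rw [← mul_sub, add_sub_add_left_eq_sub, ← Finset.sum_sub_distrib, Finset.mul_sum, Finset.mul_sum]
  refine Finset.sum_congr rfl fun i _ => ?_
  rw [coordProb_oraclePolicy, coordLoss]
  rcases Int.units_eq_one_or (ξ h i) with h1 | h1 <;> simp [h1] <;> ring

/-- The value of `π` under the least favorable kernel. -/
noncomputable def worstValue (M : LinearDRMDP HState (HAction d) (d + 2) H)
    (π : Policy HState (HAction d) H) (h : ℕ) (s : HState) : ℝ :=
  expectedSum M.reward (worstKernel M) π h s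

theorem worstValue_one (ξ : Fin H → Fin d → ℤˣ) (π : Policy HState (HAction d) H) (h : ℕ) :
    worstValue (hardInstance d H K ρ ξ) π h 1 = 0 := by
  unfold worstValue
  induction k : H - h generalizing h with
  | zero => rw [expectedSum_of_ge _ _ _ (by omega)]
  | succ k ih =>
    rw [expectedSum_of_lt _ _ _ (by omega)]
    simp [hardInstance_reward_one, worstKernel, ih (h + 1) (by omega)]

theorem worstValue_zero (ξ : Fin H → Fin d → ℤˣ) (π : Policy HState (HAction d) H) {h : ℕ}
    (hh : h < H) : worstValue (hardInstance d H K ρ ξ) π h 0 =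
      ∑ a, (π ⟨h, hh⟩ 0).1 a * (hardInstance d H K ρ ξ).reward ⟨h, hh⟩ 0 a +
      (1 - (hardInstance d H K ρ ξ).radius ⟨h, hh⟩) *
        worstValue (hardInstance d H K ρ ξ) π (h + 1) 0 := by
  have h1 := worstValue_one (K := K) (ρ := ρ) ξ π (h + 1)
  unfold worstValue at h1 ⊢
  rw [expectedSum_of_lt _ _ _ hh]
  simp_rw [Fin.sum_univ_two, h1, mul_add, Finset.sum_add_distrib, worstKernel, if_true,
    mul_zero, Finset.sum_const_zero, add_zero, ← Finset.sum_mul, (π ⟨h, hh⟩ 0).2.2]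
  simp

theorem worstValue_nonneg (hρ : 0 ≤ ρ) (hρ1 : ρ ≤ 1) (ξ : Fin H → Fin d → ℤˣ)
    (π : Policy HState (HAction d) H) (h : ℕ) (s : HState) :
    0 ≤ worstValue (hardInstance d H K ρ ξ) π h s := by
  refine expectedSum_nonneg π (fun h s a => (hardInstance_reward_mem ξ h s a).1)
    (fun h s a s' => ?_) h s
  obtain ⟨hr0, hr1⟩ := hardInstance_radius_mem (K := K) hρ hρ1 ξ h
  unfold worstKernel
  split_ifs <;> fin_cases s' <;> simp [hr0, hr1]

/-- By induction on the remaining steps: every admissible kernel keeps at least the mass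
`1 - radius` in `x₁`, and values in `x₂` are nonnegative. -/
theorem worstValue_le (hρ : 0 ≤ ρ) (hρ1 : ρ ≤ 1) (hgap : gap d K ≤ 1) (ξ : Fin H → Fin d → ℤˣ)
    (π : Policy HState (HAction d) H) {P : Transition HState (HAction d) H}
    (hP : P ∈ (hardInstance d H K ρ ξ).uncertaintySet) (h : ℕ) (s : HState) :
    worstValue (hardInstance d H K ρ ξ) π h s ≤
      expectedSum (hardInstance d H K ρ ξ).reward P π h s := by
  have hPs := (hardInstance_isLinear hρ hgap ξ).mem_stdSimplex hP
  have hnn := expectedSum_nonneg π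
    (fun h s a => (hardInstance_reward_mem (K := K) (ρ := ρ) ξ h s a).1) (fun h s a => (hPs h s a).1)
  match s with
  | 1 => rw [worstValue_one]; exact hnn h 1
  | 0 =>
    induction k : H - h generalizing h with
    | zero => rw [worstValue, expectedSum_of_ge _ _ _ (by omega), expectedSum_of_ge _ _ _ (by omega)]
    | succ k ih =>
      have hh : h < H := by omega
      obtain ⟨hr0, hr1⟩ := hardInstance_radius_mem (K := K) hρ hρ1 ξ ⟨h, hh⟩
      have h2 := (worstValue_nonneg (K := K) hρ hρ1 ξ π (h + 1) 0)
      rw [worstValue_zero _ _ hh, expectedSum_of_lt _ _ _ hh]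
      simp_rw [mul_add, Finset.sum_add_distrib]
      refine add_le_add le_rfl ?_
      calc _ = ∑ a, (π ⟨h, hh⟩ 0).1 a * ((1 - (hardInstance d H K ρ ξ).radius ⟨h, hh⟩) *
            worstValue (hardInstance d H K ρ ξ) π (h + 1) 0) := by
            rw [← Finset.sum_mul, (π ⟨h, hh⟩ 0).2.2, one_mul]
        _ ≤ _ := by
          refine Finset.sum_le_sum fun a _ => mul_le_mul_of_nonneg_left ?_ ((π _ 0).2.1 a)
          rw [Fin.sum_univ_two]
          have h3 := mul_nonneg ((hPs ⟨h, hh⟩ 0 a).1 1) (hnn (h + 1) 1)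
          have h4 := mul_le_mul (one_sub_radius_le ξ hP ⟨h, hh⟩ a) (ih (h + 1) (by omega)) h2
            ((hPs ⟨h, hh⟩ 0 a).1 0)
          linarith

theorem robustValue_eq_worstValue (hρ : 0 ≤ ρ) (hρ1 : ρ ≤ 1) (hgap : gap d K ≤ 1)
    (ξ : Fin H → Fin d → ℤˣ) (π : Policy HState (HAction d) H) (h : ℕ) (s : HState) :
    (hardInstance d H K ρ ξ).robustValue π h s = worstValue (hardInstance d H K ρ ξ) π h s := by
  have hw := worstKernel_mem (K := K) hρ hρ1 ξ
  have hle := fun P (hP : P ∈ (hardInstance d H K ρ ξ).uncertaintySet) =>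
    worstValue_le hρ hρ1 hgap ξ π hP h s
  refine le_antisymm (ciInf_le (f := fun P : (hardInstance d H K ρ ξ).uncertaintySet =>
    expectedSum (hardInstance d H K ρ ξ).reward P.1 π h s)
    ⟨worstValue (hardInstance d H K ρ ξ) π h s, ?_⟩ ⟨_, hw⟩) ?_
  · rintro _ ⟨P, rfl⟩
    exact hle P.1 P.2
  · have : Nonempty (hardInstance d H K ρ ξ).uncertaintySet := ⟨⟨_, hw⟩⟩
    exact le_ciInf fun P => hle P.1 P.2

theorem worstValue_le_oraclePolicy (hρ : 0 ≤ ρ) (hρ1 : ρ ≤ 1) (ξ : Fin H → Fin d → ℤˣ)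
    (π : Policy HState (HAction d) H) (h : ℕ) (s : HState) :
    worstValue (hardInstance d H K ρ ξ) π h s ≤
      worstValue (hardInstance d H K ρ ξ) (oraclePolicy ξ) h s := by
  match s with
  | 1 => rw [worstValue_one, worstValue_one]
  | 0 =>
    induction k : H - h generalizing h with
    | zero =>
      rw [worstValue, worstValue, expectedSum_of_ge _ _ _ (by omega),
        expectedSum_of_ge _ _ _ (by omega)]
    | succ k ih =>
      have hh : h < H := by omega
      obtain ⟨hr0, hr1⟩ := hardInstance_radius_mem (K := K) hρ hρ1 ξ ⟨h, hh⟩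
      rw [worstValue_zero _ _ hh, worstValue_zero _ _ hh]
      refine add_le_add (sub_nonneg.1 ?_)
        (mul_le_mul_of_nonneg_left (ih (h + 1) (by omega)) (by linarith))
      rw [step_regret]
      exact mul_nonneg (div_nonneg (gap_nonneg _ _) (by positivity)) (Finset.sum_nonneg fun i _ =>
        coordLoss_nonneg (coordProb_nonneg _ _ _) (coordProb_le_one _ _ _))

theorem optValue_eq_worstValue (hρ : 0 ≤ ρ) (hρ1 : ρ ≤ 1) (hgap : gap d K ≤ 1)
    (ξ : Fin H → Fin d → ℤˣ) (h : ℕ) (s : HState) :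
    (hardInstance d H K ρ ξ).optValue h s =
      worstValue (hardInstance d H K ρ ξ) (oraclePolicy ξ) h s := by
  have : Nonempty (Policy HState (HAction d) H) := ⟨oraclePolicy ξ⟩
  unfold LinearDRMDP.optValue
  simp_rw [robustValue_eq_worstValue hρ hρ1 hgap]
  have hle := fun π => worstValue_le_oraclePolicy (K := K) hρ hρ1 ξ π h s
  refine le_antisymm (ciSup_le hle) (le_ciSup (f := fun π => worstValue (hardInstance d H K ρ ξ) π h s)
    ⟨worstValue (hardInstance d H K ρ ξ) (oraclePolicy ξ) h s, ?_⟩ _)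
  rintro _ ⟨π, rfl⟩
  exact hle π

theorem oraclePolicy_isOptimal (hρ : 0 ≤ ρ) (hρ1 : ρ ≤ 1) (hgap : gap d K ≤ 1)
    (ξ : Fin H → Fin d → ℤˣ) : (hardInstance d H K ρ ξ).IsOptimal (oraclePolicy ξ) := fun h s => by
  rw [robustValue_eq_worstValue hρ hρ1 hgap, optValue_eq_worstValue hρ hρ1 hgap]

/-- From the second step on nothing is uncertain, so regrets simply add up. -/
theorem worstValue_regret_of_pos (ξ : Fin H → Fin d → ℤˣ) (π : Policy HState (HAction d) H)
    {h : ℕ} (hpos : 0 < h) :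
    worstValue (hardInstance d H K ρ ξ) (oraclePolicy ξ) h 0 -
      worstValue (hardInstance d H K ρ ξ) π h 0 =
    ∑ t : Fin H, if h ≤ t.val then
      gap d K / (2 * d) * ∑ i, coordLoss (ξ t i) (coordProb π t i) else 0 := by
  induction k : H - h generalizing h with
  | zero =>
    rw [worstValue, worstValue, expectedSum_of_ge _ _ _ (by omega),
      expectedSum_of_ge _ _ _ (by omega), sub_zero, Finset.sum_eq_zero fun t _ => ?_]
    rw [if_neg (by omega)]
  | succ k ih =>
    have hh : h < H := by omega
    have hr : (hardInstance d H K ρ ξ).radius ⟨h, hh⟩ = 0 := by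
      simp [hardInstance, hpos.ne']
    have hsplit : ∀ (g : Fin H → ℝ) (t : Fin H), (if h ≤ t.val then g t else 0) =
        (if t = ⟨h, hh⟩ then g t else 0) + if h + 1 ≤ t.val then g t else 0 := by
      intro g t
      rcases lt_trichotomy h t.val with h1 | h1 | h1
      · rw [if_pos h1.le, if_neg (by rw [Fin.ext_iff]; exact h1.ne'), if_pos (Nat.succ_le_of_lt h1),
          zero_add]
      · rw [if_pos h1.le, if_pos (Fin.ext h1.symm), if_neg (by omega), add_zero]
      · rw [if_neg (by omega), if_neg (by rw [Fin.ext_iff]; exact h1.ne), if_neg (by omega),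
          add_zero]
    refine Eq.trans ?_ (Finset.sum_congr rfl fun t _ => (hsplit (fun t =>
      gap d K / (2 * d) * ∑ i, coordLoss (ξ t i) (coordProb π t i)) t).symm)
    rw [Finset.sum_add_distrib, Finset.sum_ite_eq',
      if_pos (Finset.mem_univ _)]
    rw [← ih (by omega) (by omega), ← step_regret (ρ := ρ), worstValue_zero _ _ hh,
      worstValue_zero _ _ hh, hr]
    ring

/-- The regret decomposes over steps and coordinates. The worst kernel keeps at least mass
`1 - ρ ≥ 1 / 4` in `x₁` after the first step, so later steps lose at most the factor `4`. -/
theorem le_subOpt (hH : 0 < H) (hρ : 0 ≤ ρ) (hρ1 : ρ ≤ 3 / 4) (hgap : gap d K ≤ 1)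
    (ξ : Fin H → Fin d → ℤˣ) (π : Policy HState (HAction d) H) :
    gap d K / (8 * d) * ∑ h, ∑ i, coordLoss (ξ h i) (coordProb π h i) ≤
      (hardInstance d H K ρ ξ).subOpt π 0 := by
  have hρ1' : ρ ≤ 1 := by linarith
  rw [LinearDRMDP.subOpt, optValue_eq_worstValue hρ hρ1' hgap,
    robustValue_eq_worstValue hρ hρ1' hgap, worstValue_zero _ _ hH, worstValue_zero _ _ hH]
  have hr : (hardInstance d H K ρ ξ).radius ⟨0, hH⟩ = ρ := by simp [hardInstance]
  have h1 := worstValue_regret_of_pos (K := K) (ρ := ρ) ξ π (zero_lt_one' ℕ)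
  have h2 := step_regret (K := K) (ρ := ρ) ξ π ⟨0, hH⟩
  set g : Fin H → ℝ := fun t => gap d K / (2 * d) * ∑ i, coordLoss (ξ t i) (coordProb π t i)
    with hg
  have hg0 : ∀ t, 0 ≤ g t := fun t =>
    mul_nonneg (div_nonneg (gap_nonneg _ _) (by positivity)) (Finset.sum_nonneg fun i _ =>
      coordLoss_nonneg (coordProb_nonneg _ _ _) (coordProb_le_one _ _ _))
  have h3 : ∑ t, g t = g ⟨0, hH⟩ + ∑ t : Fin H, if 1 ≤ t.val then g t else 0 := by
    have : ∀ t : Fin H, g t = (if t = ⟨0, hH⟩ then g t else 0) + if 1 ≤ t.val then g t else 0 := by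
      intro t
      by_cases ht : t = ⟨0, hH⟩
      · simp [ht]
      · have : 1 ≤ t.val := by
          rw [Fin.ext_iff] at ht
          exact Nat.one_le_iff_ne_zero.2 ht
        simp [ht, this]
    rw [Finset.sum_congr rfl fun t _ => this t, Finset.sum_add_distrib, Finset.sum_ite_eq',
      if_pos (Finset.mem_univ _)]
  have h4 : 0 ≤ ∑ t : Fin H, if 1 ≤ t.val then g t else 0 :=
    Finset.sum_nonneg fun t _ => by split_ifs; exacts [hg0 t, le_rfl]
  have h5 : gap d K / (8 * d) * ∑ h, ∑ i, coordLoss (ξ h i) (coordProb π h i) =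
      1 / 4 * ∑ t, g t := by
    rw [hg, ← Finset.mul_sum, ← mul_assoc]
    congr 1
    ring
  rw [h5, h3, hr]
  have h6 := hg0 ⟨0, hH⟩
  change _ = g ⟨0, hH⟩ at h2
  simp only [zero_add]
  nlinarith [mul_nonneg (by linarith : (0 : ℝ) ≤ 3 / 4 - ρ) h4]

end HardInstance

/-! ### Marginals of the data distribution -/

section Paths

variable {S A : Type} {n H : ℕ} [Fintype S] [Fintype A] [DecidableEq S]

/-- If the dynamics never leave the initial state and actions are drawn from `q`, the law of a path
is a mixture over the initial state of product laws. -/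
theorem pathProb_eq_sum_prod (hH : 0 < H) (init : S → ℝ) {P : Transition S A H}
    (hP : ∀ h s a, P h s a = Pi.single s 1) {π : Policy S A H} {q : stdSimplex ℝ A}
    (hπ : ∀ h s, π h s = q) (x : Fin H → S × A) :
    pathProb init P π x =
      ∑ s, init s * ∏ h, ((if (x h).1 = s then (1 : ℝ) else 0) * q.1 (x h).2) := by
  simp_rw [pathProb, hP, hπ, Finset.prod_mul_distrib, ← mul_assoc, ← Finset.sum_mul]
  congr 1
  rw [Finset.sum_eq_single (x ⟨0, hH⟩).1]
  · by_cases hx : ∀ h, (x h).1 = (x ⟨0, hH⟩).1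
    · rw [Finset.prod_eq_single ⟨0, hH⟩]
      · simp [hx]
      · intro h _ hh
        have : 0 < h.val := Nat.pos_of_ne_zero fun h0 => hh (Fin.ext h0)
        rw [if_pos this, hx, hx h, Pi.single_eq_same]
      · simp
    -- A state path that is not constant has a jump, and then both sides vanish.
    · have hjump : ∃ h : Fin H, ∃ h0 : 0 < h.val,
          (x h).1 ≠ (x ⟨h.val - 1, by omega⟩).1 := by
        by_contra! hcon
        refine hx fun ⟨h, hh⟩ => ?_
        induction h with
        | zero => rfl
        | succ h ih => rw [hcon ⟨h + 1, hh⟩ (Nat.succ_pos h)]; exact ih (by omega)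
      obtain ⟨h, h0, hne⟩ := hjump
      obtain ⟨h', hne'⟩ := not_forall.1 hx
      rw [Finset.prod_eq_zero (Finset.mem_univ h), Finset.prod_eq_zero (Finset.mem_univ h'),
        mul_zero]
      · rw [if_neg hne']
      · rw [if_pos h0, Pi.single_eq_of_ne hne]
  · intro s _ hs
    rw [Finset.prod_eq_zero (Finset.mem_univ ⟨0, hH⟩), mul_zero]
    rw [if_neg hs.symm]
  · simp

/-- Under absorbing dynamics and a fixed action law `q`, the pair `(s_h, a_h)` has law `init ⊗ q`. -/
theorem sum_pathProb_mul (init : S → ℝ) {P : Transition S A H}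
    (hP : ∀ h s a, P h s a = Pi.single s 1) {π : Policy S A H} {q : stdSimplex ℝ A}
    (hπ : ∀ h s, π h s = q) (h : Fin H) (g : S × A → ℝ) :
    ∑ x, pathProb init P π x * g (x h) = ∑ s, init s * ∑ a, q.1 a * g (s, a) := by
  have hH : 0 < H := h.pos
  simp_rw [pathProb_eq_sum_prod hH init hP hπ, Finset.sum_mul]
  rw [Finset.sum_comm]
  refine Finset.sum_congr rfl fun s _ => ?_
  simp_rw [mul_assoc, ← Finset.mul_sum]
  congr 1
  set f : Fin H → S × A → ℝ := fun k y =>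
    (if y.1 = s then (1 : ℝ) else 0) * q.1 y.2 * if k = h then g y else 1 with hf
  have h1 : ∀ x : Fin H → S × A,
      (∏ k, (if (x k).1 = s then (1 : ℝ) else 0) * q.1 (x k).2) * g (x h) = ∏ k, f k (x k) := by
    intro x
    simp only [hf]
    rw [Finset.prod_mul_distrib (g := fun k => if k = h then g (x k) else 1),
      Finset.prod_ite_eq' Finset.univ h, if_pos (Finset.mem_univ _)]
  have hsum : ∀ f : S × A → ℝ, ∑ y : S × A, (if y.1 = s then (1 : ℝ) else 0) * q.1 y.2 * f y =
      ∑ a, q.1 a * f (s, a) := by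
    intro f
    rw [Fintype.sum_prod_type, Finset.sum_eq_single s]
    · simp
    · intro s' _ hs'
      simp [hs']
    · simp
  rw [Finset.sum_congr rfl fun x _ => h1 x, ← Fintype.prod_sum, Finset.prod_eq_single h]
  · simp only [hf, if_true]
    exact hsum g
  · intro k _ hk
    simp only [hf, if_neg hk]
    rw [hsum fun _ => 1]
    simp [q.2.2]
  · simp

end Paths

theorem pathProb_nonneg {S A : Type} {H : ℕ} [Fintype A] {init : S → ℝ} (hinit : ∀ s, 0 ≤ init s)
    {P : Transition S A H} (hP : ∀ h s a s', 0 ≤ P h s a s') (π : Policy S A H)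
    (x : Fin H → S × A) : 0 ≤ pathProb init P π x := by
  refine Finset.prod_nonneg fun h _ => mul_nonneg ?_ ((π h _).2.1 _)
  split_ifs
  exacts [hP _ _ _ _, hinit _]

/-- The action `e_i`. -/
def unitAction {d : ℕ} (i : Fin d) : HAction d := fun j => decide (j = i)

/-- The action `0`. -/
def zeroAction (d : ℕ) : HAction d := fun _ => false

theorem unitAction_injective (d : ℕ) : Function.Injective (unitAction (d := d)) := by
  intro i j h
  simpa [unitAction] using congrFun h i

theorem unitAction_ne_zeroAction {d : ℕ} (i : Fin d) : unitAction i ≠ zeroAction d := by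
  intro h
  simpa [unitAction, zeroAction] using congrFun h i

theorem probeActions_eq (d : ℕ) :
    probeActions d = insert (zeroAction d) (Finset.univ.image (unitAction (d := d))) := rfl

theorem zeroAction_notMem (d : ℕ) :
    zeroAction d ∉ Finset.univ.image (unitAction (d := d)) := by
  simpa using fun i => unitAction_ne_zeroAction i

theorem sum_probeDist_mul (d : ℕ) (f : HAction d → ℝ) :
    ∑ a, (probeDist d).1 a * f a =
      1 / ((d : ℝ) + 1) * (f (zeroAction d) + ∑ i, f (unitAction i)) := by
  have hcard : ((probeActions d).card : ℝ) = (d : ℝ) + 1 := by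
    rw [probeActions_eq, Finset.card_insert_of_notMem (zeroAction_notMem d),
      Finset.card_image_of_injective _ (unitAction_injective d)]
    simp
  simp only [probeDist, hcard, ite_mul, zero_mul]
  rw [Finset.sum_ite_mem, Finset.univ_inter, ← Finset.mul_sum, probeActions_eq,
    Finset.sum_insert (zeroAction_notMem d),
    Finset.sum_image (unitAction_injective d).injOn]

section Data

variable {d H K : ℕ} {ρ : ℝ}

/-- The marginal law of `(s_h, a_h)` in the data is the same at every step: the initial law of the
state times the uniform law on the probing actions. -/
theorem sum_hardPath_mul (ξ : Fin H → Fin d → ℤˣ) (h : Fin H) (g : HState × HAction d → ℝ) :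
    ∑ x, pathProb (hardInit d) (hardInstance d H K ρ ξ).nominal (behavior d H) x * g (x h) =
      1 / ((d : ℝ) + 2) * (g (0, zeroAction d) + ∑ i, g (0, unitAction i)) +
      1 / ((d : ℝ) + 2) * (1 / ((d : ℝ) + 1) *
        (g (1, zeroAction d) + ∑ i, g (1, unitAction i))) := by
  rw [sum_pathProb_mul (hardInit d) (hardInstance_nominal ξ) (π := behavior d H)
    (q := probeDist d) (fun _ _ => rfl) h g]
  simp_rw [sum_probeDist_mul, Fin.sum_univ_two, hardInit, Matrix.cons_val_zero,
    Matrix.cons_val_one]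
  rw [← mul_assoc]
  congr 2
  field_simp

theorem hardPath_nonneg (ξ : Fin H → Fin d → ℤˣ) (x : Fin H → HState × HAction d) :
    0 ≤ pathProb (hardInit d) (hardInstance d H K ρ ξ).nominal (behavior d H) x := by
  refine pathProb_nonneg (fun s => ?_) (fun h s a s' => ?_) _ x
  · fin_cases s <;> simp [hardInit] <;> positivity
  · rw [hardInstance_nominal, Pi.single_apply]
    split_ifs <;> norm_num

theorem sum_hardPath (hH : 0 < H) (ξ : Fin H → Fin d → ℤˣ) :
    ∑ x, pathProb (hardInit d) (hardInstance d H K ρ ξ).nominal (behavior d H) x = 1 := by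
  have := sum_hardPath_mul (K := K) (ρ := ρ) ξ ⟨0, hH⟩ fun _ => 1
  simp only [mul_one] at this
  rw [this]
  simp
  field_simp
  ring

theorem trajLaw_isProbabilityMeasure (hH : 0 < H) (ξ : Fin H → Fin d → ℤˣ) :
    IsProbabilityMeasure ((hardInstance d H K ρ ξ).trajLaw (hardInit d) (behavior d H)) := by
  refine ⟨?_⟩
  have := lintegral_trajLaw (hardInstance d H K ρ ξ) (hardInit d) (behavior d H)
    (f := fun _ _ => 1) (fun _ => measurable_const)
  simp only [Finset.prod_const_one, lintegral_const, one_mul, measure_univ, mul_one] at this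
  rw [this, ← ENNReal.ofReal_sum_of_nonneg fun x _ => hardPath_nonneg ξ x, sum_hardPath hH,
    ENNReal.ofReal_one]

theorem hardLaw_isProbabilityMeasure (hH : 0 < H) (ξ : Fin H → Fin d → ℤˣ) :
    IsProbabilityMeasure (hardLaw d H K ρ ξ) := by
  have := trajLaw_isProbabilityMeasure (K := K) (ρ := ρ) hH ξ
  unfold hardLaw LinearDRMDP.dataLaw
  infer_instance

/-- The cells into which the data distribution splits the state-action pairs it visits:
`(x₁, e_i)`, then `(x₁, 0)`, then all of `x₂`. Each has probability `1 / (d + 2)` at every step. -/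
def probeCell (d : ℕ) : Option (Option (Fin d)) → Set (HState × HAction d)
  | none => {y | y.1 = 1}
  | some none => {(0, zeroAction d)}
  | some (some i) => {(0, unitAction i)}

theorem trajLaw_probeCell (ξ : Fin H → Fin d → ℤˣ) (h : Fin H) (c : Option (Option (Fin d))) :
    (hardInstance d H K ρ ξ).trajLaw (hardInit d) (behavior d H)
      {y | ((y h).1, (y h).2.1) ∈ probeCell d c} = ENNReal.ofReal (1 / ((d : ℝ) + 2)) := by
  classical
  have hproj : Measurable fun z : HState × HAction d × ℝ => (z.1, z.2.1) := by fun_prop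
  have hC : MeasurableSet (probeCell d c) := Set.Finite.measurableSet (Set.toFinite _)
  have hm : MeasurableSet {y : Fin H → HState × HAction d × ℝ |
      ((y h).1, (y h).2.1) ∈ probeCell d c} :=
    (hproj.comp (measurable_pi_apply h)) hC
  set f : Fin H → HState × HAction d × ℝ → ENNReal := fun k z =>
    if k = h then (probeCell d c).indicator 1 (z.1, z.2.1) else 1 with hf
  have hfm : ∀ k, Measurable (f k) := by
    intro k
    by_cases hk : k = h
    · simp only [hf, hk, if_true]
      exact (measurable_one.indicator hC).comp hproj
    · simp only [hf, hk, if_false]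
      exact measurable_const
  have key := lintegral_trajLaw (hardInstance d H K ρ ξ) (hardInit d) (behavior d H) hfm
  have h1 : ∀ y : Fin H → HState × HAction d × ℝ, ∏ k, f k (y k) =
      {y : Fin H → HState × HAction d × ℝ | ((y h).1, (y h).2.1) ∈ probeCell d c}.indicator 1 y := by
    intro y
    simp only [hf, Finset.prod_ite_eq', Finset.mem_univ, if_true]
    rfl
  rw [lintegral_congr h1, lintegral_indicator_one hm] at key
  rw [key]
  have h2 : ∀ x : Fin H → HState × HAction d, ∏ k, ∫⁻ z, f k z
      ∂stepLaw (x k).1 (x k).2 ((hardInstance d H K ρ ξ).reward k (x k).1 (x k).2) =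
      ENNReal.ofReal (if x h ∈ probeCell d c then 1 else 0) := by
    intro x
    rw [Finset.prod_eq_single h]
    · rw [lintegral_stepLaw _ _ _ (hfm h)]
      simp only [hf, if_true, lintegral_const, measure_univ, mul_one]
      by_cases hx : x h ∈ probeCell d c <;> simp [hx]
    · intro k _ hk
      simp [hf, hk]
    · simp
  simp_rw [h2]
  simp_rw [← ENNReal.ofReal_mul (hardPath_nonneg ξ _)]
  rw [← ENNReal.ofReal_sum_of_nonneg fun x _ =>
    mul_nonneg (hardPath_nonneg ξ x) (by split_ifs <;> norm_num)]
  congr 1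
  rw [sum_hardPath_mul ξ h fun y => if y ∈ probeCell d c then (1 : ℝ) else 0]
  match c with
  | none =>
    simp [probeCell]
    field_simp
    ring
  | some none => simp [probeCell, unitAction_ne_zeroAction]
  | some (some i) =>
    simp [probeCell, (unitAction_ne_zeroAction i).symm, (unitAction_injective d).eq_iff]

/-! ### Empirical covariance -/

theorem dotProduct_sum_vecMulVec_mulVec {ι : Type*} [Fintype ι] {n : ℕ} (c : ι → ℝ)
    (v : ι → Fin n → ℝ) (u : Fin n → ℝ) :
    u ⬝ᵥ ((∑ τ, c τ • Matrix.vecMulVec (v τ) (v τ)) *ᵥ u) =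
      ∑ τ, c τ * (∑ i, v τ i * u i) ^ 2 := by
  rw [Matrix.sum_mulVec, dotProduct_sum]
  refine Finset.sum_congr rfl fun τ _ => ?_
  rw [Matrix.smul_mulVec, dotProduct_smul, smul_eq_mul, Matrix.vecMulVec_mulVec]
  congr 1
  rw [sq]
  simp [dotProduct, Finset.mul_sum, mul_comm, mul_left_comm]

theorem sum_smul_vecMulVec_isHermitian {ι : Type*} [Fintype ι] {n : ℕ} (c : ι → ℝ)
    (v : ι → Fin n → ℝ) : (∑ τ, c τ • Matrix.vecMulVec (v τ) (v τ)).IsHermitian := by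
  rw [Matrix.IsHermitian, Matrix.conjTranspose_sum]
  refine Finset.sum_congr rfl fun τ _ => ?_
  ext i j
  simp [Matrix.vecMulVec_apply, mul_comm]

theorem sum_hardFeature_zeroAction_mul (u : Fin (d + 2) → ℝ) :
    ∑ i, hardFeature d 0 (zeroAction d) i * u i = u (Fin.last d).castSucc := by
  rw [sum_hardFeature_zero_mul]
  simp [zeroAction, bit]

theorem sum_hardFeature_unitAction_mul (i : Fin d) (u : Fin (d + 2) → ℝ) :
    ∑ j, hardFeature d 0 (unitAction i) j * u j =
      1 / d * u i.castSucc.castSucc + (1 - 1 / d) * u (Fin.last d).castSucc := by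
  rw [sum_hardFeature_zero_mul]
  simp [unitAction, bit, ite_div, ite_mul]

/-- The coordinate functionals are controlled by the probing functionals: with
`y = u_i / d + (1 - 1 / d) z` and `z = u_{d+1}` one has `u_i = d y - (d - 1) z`. -/
theorem sq_le_of_probes (hd : 1 ≤ d) {u : Fin (d + 2) → ℝ} {Q : ℝ}
    (hunit : ∀ i : Fin d, (∑ j, hardFeature d 0 (unitAction i) j * u j) ^ 2 +
      (∑ j, hardFeature d 0 (zeroAction d) j * u j) ^ 2 ≤ Q)
    (hzero : (∑ j, hardFeature d 0 (zeroAction d) j * u j) ^ 2 ≤ Q)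
    (hsink : (∑ j, hardFeature d 1 (zeroAction d) j * u j) ^ 2 ≤ Q) (j : Fin (d + 2)) :
    u j ^ 2 ≤ 2 * (d : ℝ) ^ 2 * Q := by
  have hd' : (1 : ℝ) ≤ d := by exact_mod_cast hd
  have hQ : 0 ≤ Q := (sq_nonneg _).trans hzero
  have h1 : (1 : ℝ) ≤ 2 * (d : ℝ) ^ 2 := by nlinarith
  rw [sum_hardFeature_zeroAction_mul] at hzero
  rw [sum_hardFeature_one_mul] at hsink
  refine Fin.lastCases ?_ (fun j => Fin.lastCases ?_ (fun i => ?_) j) j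
  · nlinarith
  · nlinarith
  · have h2 := hunit i
    rw [sum_hardFeature_zeroAction_mul, sum_hardFeature_unitAction_mul] at h2
    set z := u (Fin.last d).castSucc
    set y := 1 / d * u i.castSucc.castSucc + (1 - 1 / d) * z with hy
    have h3 : u i.castSucc.castSucc = d * y - (d - 1) * z := by
      rw [hy]; field_simp; ring
    rw [h3]
    have h4 : (d * y - (d - 1) * z) ^ 2 ≤ 2 * (d : ℝ) ^ 2 * (y ^ 2 + z ^ 2) := by
      nlinarith [sq_nonneg (d * y + (d - 1) * z), mul_nonneg (sub_nonneg.2 hd') (sq_nonneg z),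
        sq_nonneg z]
    exact h4.trans (by gcongr)

/-- The quadratic form is a positive combination of the squared probing functionals, and these
vanish simultaneously only at `0`. -/
theorem hardInstance_featureCoverage (hd : 1 ≤ d) (ξ : Fin H → Fin d → ℤˣ) :
    (hardInstance d H K ρ ξ).FeatureCoverage (hardInit d) (behavior d H) := by
  intro h
  refine Matrix.PosDef.of_dotProduct_mulVec_pos (sum_smul_vecMulVec_isHermitian _ _) fun u hu => ?_
  rw [star_trivial, dotProduct_sum_vecMulVec_mulVec, sum_hardPath_mul ξ h fun y =>
    (∑ i, (hardInstance d H K ρ ξ).φ y.1 y.2 i * u i) ^ 2]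
  simp only [hardInstance]
  by_contra! hcon
  set T : HState → HAction d → ℝ := fun s a => (∑ j, hardFeature d s a j * u j) ^ 2 with hT
  have hT0 : ∀ s a, 0 ≤ T s a := fun s a => sq_nonneg _
  have hS0 : ∀ s, 0 ≤ ∑ i, T s (unitAction i) := fun s => Finset.sum_nonneg fun i _ => hT0 _ _
  have hp : (0 : ℝ) < 1 / (d + 2) := by positivity
  have hp1 : (0 : ℝ) < 1 / (d + 1) := by positivity
  change 1 / ((d : ℝ) + 2) * (T 0 (zeroAction d) + ∑ i, T 0 (unitAction i)) +
    1 / ((d : ℝ) + 2) * (1 / ((d : ℝ) + 1) * (T 1 (zeroAction d) + ∑ i, T 1 (unitAction i))) ≤ 0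
    at hcon
  have ha : 0 ≤ T 0 (zeroAction d) + ∑ i, T 0 (unitAction i) := add_nonneg (hT0 _ _) (hS0 _)
  have hb : 0 ≤ T 1 (zeroAction d) + ∑ i, T 1 (unitAction i) := add_nonneg (hT0 _ _) (hS0 _)
  have hA : T 0 (zeroAction d) + ∑ i, T 0 (unitAction i) ≤ 0 := by
    by_contra! hpos
    have := mul_pos hp hpos
    have := mul_nonneg hp.le (mul_nonneg hp1.le hb)
    linarith
  have hB : T 1 (zeroAction d) + ∑ i, T 1 (unitAction i) ≤ 0 := by
    by_contra! hpos
    have := mul_pos hp (mul_pos hp1 hpos)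
    have := mul_nonneg hp.le ha
    linarith
  have hu0 := sq_le_of_probes hd (u := u) (Q := 0)
    (fun i => by
      have h1 := Finset.single_le_sum (fun i _ => hT0 0 (unitAction i)) (Finset.mem_univ i)
      change T 0 (unitAction i) + T 0 (zeroAction d) ≤ 0
      linarith)
    (by
      have := hS0 0
      change T 0 (zeroAction d) ≤ 0
      linarith)
    (by
      have := hS0 1
      change T 1 (zeroAction d) ≤ 0
      linarith)
  refine hu (funext fun j => ?_)
  have := hu0 j
  rw [mul_zero] at this
  exact pow_eq_zero_iff two_ne_zero |>.1 (le_antisymm this (sq_nonneg _))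

theorem dotProduct_empCov_mulVec (M : LinearDRMDP HState (HAction d) (d + 2) H) (lam : ℝ)
    (D : Dataset HState (HAction d) H K) (h : Fin H) (u : Fin (d + 2) → ℝ) :
    u ⬝ᵥ (M.empCov lam D h *ᵥ u) =
      ∑ τ, (∑ i, M.φ (D τ h).1 (D τ h).2.1 i * u i) ^ 2 + lam * u ⬝ᵥ u := by
  have := dotProduct_sum_vecMulVec_mulVec (fun _ : Fin K => (1 : ℝ))
    (fun τ => M.φ (D τ h).1 (D τ h).2.1) u
  simp only [one_smul, one_mul] at this
  rw [LinearDRMDP.empCov, Matrix.add_mulVec, dotProduct_add, this, Matrix.smul_mulVec,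
    Matrix.one_mulVec, dotProduct_smul, smul_eq_mul]

theorem empCov_posDef (M : LinearDRMDP HState (HAction d) (d + 2) H) {lam : ℝ} (hlam : 0 < lam)
    (D : Dataset HState (HAction d) H K) (h : Fin H) : (M.empCov lam D h).PosDef := by
  refine Matrix.PosDef.of_dotProduct_mulVec_pos ?_ fun u hu => ?_
  · have := sum_smul_vecMulVec_isHermitian (fun _ : Fin K => (1 : ℝ))
      (fun τ => M.φ (D τ h).1 (D τ h).2.1)
    simp only [one_smul] at this
    refine this.add ?_
    simp [Matrix.IsHermitian]
  · rw [star_trivial, dotProduct_empCov_mulVec]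
    have h1 : 0 < u ⬝ᵥ u := by
      have := Matrix.dotProduct_star_self_pos_iff (v := u)
      simpa using this.2 hu
    have h2 : 0 ≤ ∑ τ, (∑ i, M.φ (D τ h).1 (D τ h).2.1 i * u i) ^ 2 :=
      Finset.sum_nonneg fun _ _ => sq_nonneg _
    have := mul_pos hlam h1
    linarith

/-- A coordinate bound `u_i² ≤ B uᵀ G u` bounds the `i`-th diagonal entry of `G⁻¹` by `B`. -/
theorem matNorm_inv_single_le {n : ℕ} {G : Matrix (Fin n) (Fin n) ℝ} (hG : G.PosDef) {B : ℝ}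
    (hB : 0 ≤ B) (i : Fin n) (hi : ∀ u : Fin n → ℝ, u i ^ 2 ≤ B * u ⬝ᵥ (G *ᵥ u)) {x : ℝ}
    (hx : 0 ≤ x) : matNorm G⁻¹ (Pi.single i x) ≤ x * Real.sqrt B := by
  have hdet : IsUnit G.det := (Matrix.isUnit_iff_isUnit_det _).1 hG.isUnit
  -- For `v = x 1_i` and `w = G⁻¹ v`, the squared norm is `vᵀ G⁻¹ v = wᵀ G w = x w_i`.
  set w := G⁻¹ *ᵥ (Pi.single i x : Fin n → ℝ) with hw
  have hGw : G *ᵥ w = Pi.single i x := by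
    rw [hw, Matrix.mulVec_mulVec, Matrix.mul_nonsing_inv _ hdet, Matrix.one_mulVec]
  have h1 := hi w
  rw [hGw, dotProduct_single] at h1
  rw [matNorm, ← hw, single_dotProduct]
  refine Real.sqrt_le_iff.2 ⟨by positivity, ?_⟩
  rw [mul_pow, Real.sq_sqrt hB]
  have h2 : w i ≤ x * B := by
    by_contra! hcon
    have h3 : 0 ≤ x * B := mul_nonneg hx hB
    nlinarith
  nlinarith

/-- Enough samples in every cell make all diagonal entries of the inverse covariance `O(d³ / K)`. -/
theorem sq_le_empCov (hd : 1 ≤ d) (hK : 0 < K) {lam : ℝ} (hlam : 0 < lam) (ξ : Fin H → Fin d → ℤˣ)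
    (D : Dataset HState (HAction d) H K) (h : Fin H)
    [∀ c : Option (Option (Fin d)), DecidablePred (· ∈ probeCell d c)]
    (hD : ∀ c, 1 / ((d : ℝ) + 2) * K / 2 ≤
      ∑ τ, if ((D τ h).1, (D τ h).2.1) ∈ probeCell d c then (1 : ℝ) else 0)
    (u : Fin (d + 2) → ℝ) (j : Fin (d + 2)) :
    u j ^ 2 ≤ 12 * (d : ℝ) ^ 3 / K * u ⬝ᵥ ((hardInstance d H K ρ ξ).empCov lam D h *ᵥ u) := by
  have hd' : (1 : ℝ) ≤ d := by exact_mod_cast hd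
  have hK' : (0 : ℝ) < K := by exact_mod_cast hK
  set N := 1 / ((d : ℝ) + 2) * K / 2 with hN
  have hN0 : 0 < N := by positivity
  set q := u ⬝ᵥ ((hardInstance d H K ρ ξ).empCov lam D h *ᵥ u) with hq
  set T : HState × HAction d → ℝ := fun y => (∑ j, hardFeature d y.1 y.2 j * u j) ^ 2 with hT
  have hT0 : ∀ y, 0 ≤ T y := fun y => sq_nonneg _
  have hu0 : 0 ≤ u ⬝ᵥ u := by simpa using dotProduct_star_self_nonneg u
  have hq1 : ∑ τ, T ((D τ h).1, (D τ h).2.1) ≤ q := by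
    rw [hq, dotProduct_empCov_mulVec]
    have := mul_nonneg hlam.le hu0
    simp only [hardInstance, hT]
    linarith
  -- on each cell the probing functional is constant
  have hpart : ∀ (c : Option (Option (Fin d))) (t : ℝ), 0 ≤ t → (∀ y ∈ probeCell d c, T y = t) →
      N * t ≤ ∑ τ, (if ((D τ h).1, (D τ h).2.1) ∈ probeCell d c then
        T ((D τ h).1, (D τ h).2.1) else 0) := by
    intro c t ht hc
    calc N * t ≤ (∑ τ, if ((D τ h).1, (D τ h).2.1) ∈ probeCell d c then (1 : ℝ) else 0) * t := by
          gcongr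
          exact hD c
      _ = _ := by
          rw [Finset.sum_mul]
          refine Finset.sum_congr rfl fun τ _ => ?_
          split_ifs with hy
          · rw [hc _ hy, one_mul]
          · rw [zero_mul]
  have hle : ∀ c, ∑ τ, (if ((D τ h).1, (D τ h).2.1) ∈ probeCell d c then
      T ((D τ h).1, (D τ h).2.1) else 0) ≤ q := fun c => by
    refine le_trans (Finset.sum_le_sum fun τ _ => ?_) hq1
    split_ifs
    exacts [le_rfl, hT0 _]
  have hsingle := fun c t ht hc => le_div_iff₀' hN0 |>.2 ((hpart c t ht hc).trans (hle c))
  have hfin := sq_le_of_probes hd (u := u) (Q := q / N)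
    (fun i => by
      have h1 := hpart (some (some i)) (T (0, unitAction i)) (hT0 _) (by simp [probeCell])
      have h2 := hpart (some none) (T (0, zeroAction d)) (hT0 _) (by simp [probeCell])
      change T (0, unitAction i) + T (0, zeroAction d) ≤ q / N
      rw [le_div_iff₀' hN0, mul_add]
      refine (add_le_add h1 h2).trans (le_trans ?_ hq1)
      rw [← Finset.sum_add_distrib]
      refine Finset.sum_le_sum fun τ _ => ?_
      by_cases ha : ((D τ h).1, (D τ h).2.1) = (0, unitAction i)
      · rw [ha]
        simp [probeCell, unitAction_ne_zeroAction]
      · have : ((D τ h).1, (D τ h).2.1) ∉ probeCell d (some (some i)) := ha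
        rw [if_neg this, zero_add]
        split_ifs
        exacts [le_rfl, hT0 _])
    (hsingle (some none) (T (0, zeroAction d)) (hT0 _) (by simp [probeCell]))
    (hsingle none (T (1, zeroAction d)) (hT0 _) (by
      rintro ⟨s, a⟩ rfl
      simp only [hT, sum_hardFeature_one_mul])) j
  refine hfin.trans ?_
  have hq0 : 0 ≤ q := (Finset.sum_nonneg fun τ _ => hT0 _).trans hq1
  rw [show 2 * (d : ℝ) ^ 2 * (q / N) = 4 * (d : ℝ) ^ 2 * (d + 2) / K * q by
    rw [hN]; field_simp; ring]
  have h5 : 4 * (d : ℝ) ^ 2 * (d + 2) ≤ 12 * (d : ℝ) ^ 3 := by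
    nlinarith [mul_nonneg (sq_nonneg (d : ℝ)) (sub_nonneg.2 hd')]
  exact mul_le_mul_of_nonneg_right (div_le_div_of_nonneg_right h5 hK'.le) hq0

theorem uncertaintyFn_le (hd : 1 ≤ d) (hK : 0 < K) (hρ : 0 ≤ ρ) (hρ1 : ρ ≤ 1) (hgap : gap d K ≤ 1)
    {lam : ℝ} (hlam : 0 < lam) (ξ : Fin H → Fin d → ℤˣ) (D : Dataset HState (HAction d) H K)
    [∀ c : Option (Option (Fin d)), DecidablePred (· ∈ probeCell d c)]
    (hD : ∀ h c, 1 / ((d : ℝ) + 2) * K / 2 ≤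
      ∑ τ, if ((D τ h).1, (D τ h).2.1) ∈ probeCell d c then (1 : ℝ) else 0)
    (π : Policy HState (HAction d) H) (s : HState) :
    (hardInstance d H K ρ ξ).uncertaintyFn ((hardInstance d H K ρ ξ).empCov lam D) π s ≤
      5 * H * gap d K := by
  have : Nonempty (hardInstance d H K ρ ξ).uncertaintySet := ⟨⟨_, worstKernel_mem hρ hρ1 ξ⟩⟩
  set B : ℝ := 12 * (d : ℝ) ^ 3 / K with hB
  have hB0 : 0 ≤ B := by positivity
  have hBg : Real.sqrt B ≤ 5 * gap d K := by
    refine Real.sqrt_le_iff.2 ⟨mul_nonneg (by norm_num) (gap_nonneg _ _), ?_⟩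
    have h1 : (0 : ℝ) ≤ (d : ℝ) ^ 3 / K := by positivity
    rw [mul_pow, sq_gap, hB, mul_div_assoc, mul_comm 2 (K : ℝ), ← div_div]
    linarith
  refine ciSup_le fun P => ?_
  refine (expectedSum_le π (B := Real.sqrt B) (fun h s a => ?_)
    ((hardInstance_isLinear hρ hgap ξ).mem_stdSimplex P.2) 0 s).trans ?_
  · calc _ ≤ ∑ i, hardFeature d s a i * Real.sqrt B := Finset.sum_le_sum fun i _ =>
          matNorm_inv_single_le (empCov_posDef _ hlam D h) hB0 i
            (fun u => sq_le_empCov hd hK hlam ξ D h (hD h) u i) (hardFeature_nonneg d s a i)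
      _ = Real.sqrt B := by rw [← Finset.sum_mul, sum_hardFeature, one_mul]
  · rw [Nat.sub_zero, mul_comm 5 (H : ℝ), mul_assoc]
    gcongr

/-- The nominal kernel is deterministic, so every variance is `0` and is truncated to `1`. -/
theorem weightedCov_eq_empCov (lam : ℝ) (ξ : Fin H → Fin d → ℤˣ)
    (D : Dataset HState (HAction d) H K) (h : Fin H) :
    (hardInstance d H K ρ ξ).weightedCov lam D h = (hardInstance d H K ρ ξ).empCov lam D h := by
  have hvar : ∀ V s a, (hardInstance d H K ρ ξ).truncVar V h s a = 1 := by
    intro V s a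
    simp [LinearDRMDP.truncVar, LinearDRMDP.nominalVar, hardInstance_nominal, Pi.single_apply]
  simp [LinearDRMDP.weightedCov, LinearDRMDP.empCov, hvar]

end Data

section Minimax

variable {d H K : ℕ} {ρ : ℝ}

/-! ### The minimax lower bound -/

/-- The sign pattern `ξ` with the sign of coordinate `i` at step `h` reversed. -/
def flipSign (ξ : Fin H → Fin d → ℤˣ) (h : Fin H) (i : Fin d) : Fin H → Fin d → ℤˣ :=
  Function.update ξ h (Function.update (ξ h) i (-ξ h i))

theorem flipSign_same (ξ : Fin H → Fin d → ℤˣ) (h : Fin H) (i : Fin d) :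
    flipSign ξ h i h i = -ξ h i := by simp [flipSign]

theorem flipSign_involutive (h : Fin H) (i : Fin d) :
    Function.Involutive fun ξ : Fin H → Fin d → ℤˣ => flipSign ξ h i := by
  intro ξ
  simp [flipSign]

/-- Flipping one sign changes the mean rewards only in `x₁`, at one step, for actions using the
flipped coordinate, and there by `gap / d`. -/
theorem sum_sq_reward_sub_flipSign (ξ : Fin H → Fin d → ℤˣ) (h : Fin H) (i : Fin d)
    (x : Fin H → HState × HAction d) :
    ∑ k, ((hardInstance d H K ρ (flipSign ξ h i)).reward k (x k).1 (x k).2 -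
      (hardInstance d H K ρ ξ).reward k (x k).1 (x k).2) ^ 2 =
      if (x h).1 = 0 then gap d K ^ 2 / (d : ℝ) ^ 2 * bit ((x h).2 i) else 0 := by
  have hstate : ∀ s : HState, s = 0 ∨ s = 1 := by decide
  have hbit : ∀ b, bit b ^ 2 = bit b := by intro b; cases b <;> simp [bit]
  rw [Finset.sum_eq_single h]
  · rcases hstate (x h).1 with hs | hs
    · rw [hs, hardInstance_reward_zero, hardInstance_reward_zero, if_pos rfl, ← mul_sub,
        add_sub_add_left_eq_sub, ← Finset.sum_sub_distrib, Finset.sum_eq_single i]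
      · rw [flipSign_same]
        rcases Int.units_eq_one_or (ξ h i) with h1 | h1 <;> rw [h1] <;> push_cast <;>
          linear_combination gap d K ^ 2 / (d : ℝ) ^ 2 * hbit ((x h).2 i)
      · intro j _ hj
        simp [flipSign, hj]
      · simp
    · rw [hs, hardInstance_reward_one, hardInstance_reward_one]
      simp
  · intro k _ hk
    rcases hstate (x k).1 with hs | hs
    · rw [hs, hardInstance_reward_zero, hardInstance_reward_zero]
      simp [flipSign, hk]
    · rw [hs, hardInstance_reward_one, hardInstance_reward_one]
      simp
  · simp

/-- The probability `1 / (d + 2)` of seeing an informative step compensates the gap, so that `K`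
trajectories carry bounded information on a single sign. -/
theorem lintegral_trajRatio_flipSign_sq_le (hd : 1 ≤ d) (hK : d ≤ K) (ξ : Fin H → Fin d → ℤˣ)
    (h : Fin H) (i : Fin d) :
    ∫⁻ y, trajRatio (hardInstance d H K ρ ξ) (hardInstance d H K ρ (flipSign ξ h i)) y ^ 2
      ∂(hardInstance d H K ρ ξ).trajLaw (hardInit d) (behavior d H) ≤
      ENNReal.ofReal (Real.exp (1 / K)) := by
  rw [lintegral_trajRatio_sq]
  simp_rw [sum_sq_reward_sub_flipSign, ← ENNReal.ofReal_mul (hardPath_nonneg ξ _)]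
  rw [← ENNReal.ofReal_sum_of_nonneg fun x _ =>
    mul_nonneg (hardPath_nonneg ξ x) (Real.exp_nonneg _)]
  refine ENNReal.ofReal_le_ofReal ?_
  rw [sum_hardPath_mul ξ h fun y =>
    Real.exp (if y.1 = 0 then gap d K ^ 2 / (d : ℝ) ^ 2 * bit (y.2 i) else 0)]
  have hd' : (1 : ℝ) ≤ d := by exact_mod_cast hd
  have hK' : (d : ℝ) ≤ K := by exact_mod_cast hK
  have hK0 : (0 : ℝ) < K := by linarith
  set κ := gap d K ^ 2 / (d : ℝ) ^ 2 with hκ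
  have hκ1 : κ = d / (2 * K) := by
    rw [hκ, sq_gap]; field_simp
  have hκ0 : 0 ≤ κ := by positivity
  have hκ2 : κ ≤ 1 / 2 := by
    rw [hκ1, div_le_div_iff₀ (by positivity) (by norm_num)]; linarith
  have hexp : Real.exp κ ≤ 1 + 2 * κ := by
    have h1 := Real.add_one_le_exp (-κ)
    have h2 : Real.exp κ * Real.exp (-κ) = 1 := by rw [← Real.exp_add]; simp
    have h3 := Real.exp_pos κ
    have h4 : Real.exp κ * (1 - κ) ≤ 1 := by
      rw [← h2]; exact mul_le_mul_of_nonneg_left (by linarith) h3.le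
    have h5 : 1 ≤ (1 + 2 * κ) * (1 - κ) := by nlinarith
    exact le_of_mul_le_mul_right (h4.trans h5) (by linarith)
  have hsum : ∑ j : Fin d, Real.exp (κ * bit (unitAction j i)) = d - 1 + Real.exp κ := by
    rw [← Finset.add_sum_erase _ _ (Finset.mem_univ i), Finset.sum_congr rfl fun j hj => by
      rw [unitAction, decide_eq_false (Finset.ne_of_mem_erase hj).symm]]
    simp [unitAction, bit, Finset.card_erase_of_mem, Nat.cast_sub hd]
    ring
  have hbit : bit (zeroAction d i) = 0 := by simp [zeroAction, bit]
  simp only [if_true, one_ne_zero, if_false, hsum, hbit, Real.exp_zero, mul_zero]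
  simp only [Finset.sum_const, Finset.card_univ, Fintype.card_fin, nsmul_eq_mul, mul_one]
  calc _ = 1 + (Real.exp κ - 1) / (d + 2) := by field_simp; ring
    _ ≤ 1 + 2 * κ / (d + 2) := by gcongr; linarith
    _ ≤ 1 + 1 / K := by
      rw [hκ1, add_le_add_iff_left, div_le_div_iff₀ (by positivity) hK0]
      field_simp
      linarith
    _ ≤ Real.exp (1 / K) := by
      have := Real.add_one_le_exp (1 / (K : ℝ)); linarith

/-- The likelihood ratio of a dataset under two sign patterns. -/
noncomputable def dataRatio (ρ : ℝ) (ξ ξ' : Fin H → Fin d → ℤˣ)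
    (D : Dataset HState (HAction d) H K) : ENNReal :=
  ∏ τ, trajRatio (hardInstance d H K ρ ξ) (hardInstance d H K ρ ξ') (D τ)

theorem measurable_dataRatio (ξ ξ' : Fin H → Fin d → ℤˣ) :
    Measurable (dataRatio (K := K) ρ ξ ξ') := by
  have := measurable_trajRatio (hardInstance d H K ρ ξ) (hardInstance d H K ρ ξ')
  unfold dataRatio
  exact Finset.measurable_prod _ fun τ _ => this.comp (measurable_pi_apply τ)

theorem hardLaw_eq_withDensity (hH : 0 < H) (ξ ξ' : Fin H → Fin d → ℤˣ) :
    hardLaw d H K ρ ξ' = (hardLaw d H K ρ ξ).withDensity (dataRatio ρ ξ ξ') := by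
  have h1 := trajLaw_withDensity_trajRatio (hardInstance d H K ρ ξ) (hardInstance d H K ρ ξ')
    rfl (hardInit d) (behavior d H)
  have h2 := trajLaw_isProbabilityMeasure (K := K) (ρ := ρ) hH ξ
  have h3 := trajLaw_isProbabilityMeasure (K := K) (ρ := ρ) hH ξ'
  have h4 : SigmaFinite (((hardInstance d H K ρ ξ).trajLaw (hardInit d)
      (behavior d H)).withDensity
        (trajRatio (hardInstance d H K ρ ξ) (hardInstance d H K ρ ξ'))) := by
    rw [h1]; infer_instance
  have key := pi_withDensity
    (fun _ : Fin K => (hardInstance d H K ρ ξ).trajLaw (hardInit d) (behavior d H))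
    (fun _ => measurable_trajRatio (hardInstance d H K ρ ξ) (hardInstance d H K ρ ξ'))
  simp_rw [h1] at key
  exact key

theorem lintegral_dataRatio_flipSign_sq_le (hd : 1 ≤ d) (hK : d ≤ K) (ξ : Fin H → Fin d → ℤˣ)
    (h : Fin H) (i : Fin d) :
    ∫⁻ D, dataRatio ρ ξ (flipSign ξ h i) D ^ 2 ∂hardLaw d H K ρ ξ ≤ 3 := by
  have := trajLaw_isProbabilityMeasure (K := K) (ρ := ρ) h.pos ξ
  set l := trajRatio (hardInstance d H K ρ ξ) (hardInstance d H K ρ (flipSign ξ h i)) with hl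
  have hlm : Measurable fun y => l y ^ 2 := (measurable_trajRatio _ _).pow_const 2
  have h1 : ∀ D : Dataset HState (HAction d) H K,
      dataRatio ρ ξ (flipSign ξ h i) D ^ 2 = ∏ τ, (fun y => l y ^ 2) (D τ) := fun D =>
    (Finset.prod_pow _ _ _).symm
  rw [lintegral_congr h1, hardLaw, LinearDRMDP.dataLaw,
    lintegral_pi_prod_eq_prod (fun _ : Fin K =>
      (hardInstance d H K ρ ξ).trajLaw (hardInit d) (behavior d H)) fun _ => hlm,
    Finset.prod_const, Finset.card_univ, Fintype.card_fin]
  have hK0 : (K : ℝ) ≠ 0 := by exact_mod_cast (by omega : K ≠ 0)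
  calc _ ≤ ENNReal.ofReal (Real.exp (1 / K)) ^ K := by
        gcongr
        exact lintegral_trajRatio_flipSign_sq_le hd hK ξ h i
    _ = ENNReal.ofReal (Real.exp 1) := by
        rw [← ENNReal.ofReal_pow (Real.exp_nonneg _), ← Real.exp_nat_mul, mul_one_div_cancel hK0]
    _ ≤ ENNReal.ofReal 3 := ENNReal.ofReal_le_ofReal Real.exp_one_lt_three.le
    _ = 3 := by norm_num

theorem coordLoss_neg (x : ℤˣ) (p : ℝ) : coordLoss (-x) p = 1 - coordLoss x p := by
  rcases Int.units_eq_one_or x with h | h <;> rw [h] <;> simp [coordLoss]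

/-- **Assouad's method.** Averaging over all sign patterns, each of the `d H` signs contributes a
constant fraction of `gap / d` to the regret of any estimator. -/
theorem le_minimaxRisk (hd : 1 ≤ d) (hH : 0 < H) (hK : d ≤ K) (hρ : 0 ≤ ρ) (hρ1 : ρ ≤ 3 / 4)
    (hgap : gap d K ≤ 1) :
    ENNReal.ofReal (H * gap d K / 64) ≤ minimaxRisk d H K ρ 0 := by
  refine le_iInf fun ⟨πhat, hπ⟩ => ?_
  set F : (Fin H → Fin d → ℤˣ) → ENNReal := fun ξ =>
    ∫⁻ D, ENNReal.ofReal ((hardInstance d H K ρ ξ).subOpt (πhat D) 0) ∂(hardLaw d H K ρ ξ) with hF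
  change _ ≤ ⨆ ξ, F ξ
  set G : (Fin H → Fin d → ℤˣ) → Fin H → Fin d → ENNReal := fun ξ h i =>
    ∫⁻ D, ENNReal.ofReal (coordLoss (ξ h i) (coordProb (πhat D) h i)) ∂(hardLaw d H K ρ ξ) with hG
  have hp : ∀ h i, Measurable fun D => coordProb (πhat D) h i := by
    intro h i
    unfold coordProb
    refine Finset.measurable_sum _ fun a _ => Measurable.mul_const ?_ _
    exact (measurable_pi_apply a).comp (measurable_subtype_coe.comp
      ((measurable_pi_apply (0 : HState)).comp ((measurable_pi_apply h).comp hπ)))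
  have hl : ∀ x h i, Measurable fun D => coordLoss x (coordProb (πhat D) h i) := by
    intro x h i
    have := hp h i
    unfold coordLoss
    split_ifs
    · exact measurable_const.sub this
    · exact this
  have hl0 : ∀ x h i D, 0 ≤ coordLoss x (coordProb (πhat D) h i) := fun x h i D =>
    coordLoss_nonneg (coordProb_nonneg _ _ _) (coordProb_le_one _ _ _)
  have hg0 : 0 ≤ gap d K / (8 * d) := div_nonneg (gap_nonneg _ _) (by positivity)
  have hFG : ∀ ξ, ENNReal.ofReal (gap d K / (8 * d)) * ∑ h, ∑ i, G ξ h i ≤ F ξ := by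
    intro ξ
    have hm : ∀ h i, Measurable fun D =>
        ENNReal.ofReal (coordLoss (ξ h i) (coordProb (πhat D) h i)) := fun h i =>
      ENNReal.measurable_ofReal.comp (hl _ h i)
    have h1 : ∑ h, ∑ i, G ξ h i = ∫⁻ D, ∑ h, ∑ i,
        ENNReal.ofReal (coordLoss (ξ h i) (coordProb (πhat D) h i)) ∂(hardLaw d H K ρ ξ) := by
      rw [lintegral_finsetSum _ fun h _ => Finset.measurable_sum _ fun i _ => hm h i]
      exact Finset.sum_congr rfl fun h _ => (lintegral_finsetSum _ fun i _ => hm h i).symm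
    rw [h1, ← lintegral_const_mul _ (Finset.measurable_sum _ fun h _ =>
      Finset.measurable_sum _ fun i _ => hm h i)]
    refine lintegral_mono fun D => ?_
    refine le_trans (le_of_eq ?_) (ENNReal.ofReal_le_ofReal (le_subOpt hH hρ hρ1 hgap ξ (πhat D)))
    rw [ENNReal.ofReal_mul hg0, ENNReal.ofReal_sum_of_nonneg fun h _ =>
      Finset.sum_nonneg fun i _ => hl0 _ _ _ _]
    congr 1
    exact Finset.sum_congr rfl fun h _ =>
      (ENNReal.ofReal_sum_of_nonneg fun i _ => hl0 _ _ _ _).symm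
  set N : ENNReal := (Fintype.card (Fin H → Fin d → ℤˣ) : ENNReal) with hN
  have hN0 : N ≠ 0 := by simp [hN]
  have hNt : N ≠ ⊤ := ENNReal.natCast_ne_top _
  have htwo : ∀ ξ h i, ENNReal.ofReal (1 / 4) ≤ G ξ h i + G (flipSign ξ h i) h i := by
    intro ξ h i
    have hprob := hardLaw_isProbabilityMeasure (K := K) (ρ := ρ) hH (flipSign ξ h i)
    refine (two_point_le _ _ (measurable_dataRatio ξ (flipSign ξ h i))
      (hardLaw_eq_withDensity hH ξ (flipSign ξ h i)) hprob.measure_univ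
      (lintegral_dataRatio_flipSign_sq_le hd hK ξ h i) (hl (ξ h i) h i) (hl0 _ _ _)
      (fun D => ?_)).trans (le_of_eq ?_)
    · have := hl0 (-ξ h i) h i D
      rw [coordLoss_neg] at this
      linarith
    · simp only [hG, flipSign_same, coordLoss_neg]
  have hGsum : ∀ h i, N * ENNReal.ofReal (1 / 8) ≤ ∑ ξ, G ξ h i := by
    intro h i
    -- Pair every sign pattern with its flip.
    have h1 : ∑ ξ, G (flipSign ξ h i) h i = ∑ ξ, G ξ h i :=
      Equiv.sum_comp (flipSign_involutive h i).toPerm fun ξ => G ξ h i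
    have h2 : N * ENNReal.ofReal (1 / 4) ≤ ∑ ξ, (G ξ h i + G (flipSign ξ h i) h i) := by
      rw [hN, ← nsmul_eq_mul, ← Finset.card_univ]
      exact Finset.card_nsmul_le_sum _ _ _ fun ξ _ => htwo ξ h i
    rw [Finset.sum_add_distrib, h1, ← two_mul] at h2
    have h3 : ENNReal.ofReal (1 / 4) = 2 * ENNReal.ofReal (1 / 8) := by
      rw [show (2 : ENNReal) = ENNReal.ofReal 2 by norm_num, ← ENNReal.ofReal_mul (by norm_num)]
      norm_num
    rw [h3, mul_left_comm] at h2
    exact (ENNReal.mul_le_mul_iff_right two_ne_zero ENNReal.ofNat_ne_top).1 h2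
  refine (ENNReal.mul_le_mul_iff_right hN0 hNt).1 ?_
  have hd0 : (d : ℝ) ≠ 0 := by exact_mod_cast (by omega : d ≠ 0)
  calc N * ENNReal.ofReal (H * gap d K / 64)
      = ENNReal.ofReal (gap d K / (8 * d)) * ∑ _h : Fin H, ∑ _i : Fin d,
          N * ENNReal.ofReal (1 / 8) := by
        simp only [Finset.sum_const, Finset.card_univ, Fintype.card_fin, nsmul_eq_mul]
        rw [← ENNReal.ofReal_natCast H, ← ENNReal.ofReal_natCast d,
          mul_left_comm (ENNReal.ofReal d) N, mul_left_comm (ENNReal.ofReal H) N,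
          mul_left_comm _ N, ← ENNReal.ofReal_mul (by positivity),
          ← ENNReal.ofReal_mul (by positivity), ← ENNReal.ofReal_mul hg0]
        congr 2
        field_simp
        norm_num
    _ ≤ ENNReal.ofReal (gap d K / (8 * d)) * ∑ h, ∑ i, ∑ ξ, G ξ h i := by
        gcongr with h _ i _
        exact hGsum h i
    _ = ∑ ξ, ENNReal.ofReal (gap d K / (8 * d)) * ∑ h, ∑ i, G ξ h i := by
        rw [← Finset.mul_sum]
        congr 1
        rw [Finset.sum_congr rfl fun h _ => Finset.sum_comm (f := fun i ξ => G ξ h i),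
          Finset.sum_comm]
    _ ≤ ∑ ξ, F ξ := Finset.sum_le_sum fun ξ _ => hFG ξ
    _ ≤ ∑ _ξ : Fin H → Fin d → ℤˣ, ⨆ ξ, F ξ := Finset.sum_le_sum fun ξ _ => le_iSup F ξ
    _ = N * ⨆ ξ, F ξ := by rw [Finset.sum_const, nsmul_eq_mul, Finset.card_univ]

end Minimax

/-! ### The high-probability event -/

section Coverage

variable {d H K : ℕ} {ρ : ℝ}

theorem hardLaw_count_lt_le (ξ : Fin H → Fin d → ℤˣ) (h : Fin H) (c : Option (Option (Fin d)))
    [DecidablePred (· ∈ probeCell d c)] :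
    hardLaw d H K ρ ξ {D | ∑ τ, (if ((D τ h).1, (D τ h).2.1) ∈ probeCell d c
      then (1 : ℝ) else 0) < 1 / ((d : ℝ) + 2) * K / 2} ≤
      ENNReal.ofReal (Real.exp (-(1 / ((d : ℝ) + 2) * K / 8))) := by
  have := trajLaw_isProbabilityMeasure (K := K) (ρ := ρ) h.pos ξ
  have hproj : Measurable fun y : Fin H → HState × HAction d × ℝ => ((y h).1, (y h).2.1) := by
    fun_prop
  have hC : MeasurableSet (probeCell d c) := Set.Finite.measurableSet (Set.toFinite _)
  let _ : DecidablePred (· ∈ (fun y : Fin H → HState × HAction d × ℝ =>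
      ((y h).1, (y h).2.1)) ⁻¹' probeCell d c) := fun y =>
    inferInstanceAs (Decidable (((y h).1, (y h).2.1) ∈ probeCell d c))
  exact chernoff_count ((hardInstance d H K ρ ξ).trajLaw (hardInit d) (behavior d H)) K
    (hproj hC) (by positivity) (trajLaw_probeCell ξ h c).ge

theorem one_sub_le_hardLaw_counts {δ : ℝ} (hδ : 0 ≤ δ) (hH : 0 < H) (ξ : Fin H → Fin d → ℤˣ)
    [∀ c : Option (Option (Fin d)), DecidablePred (· ∈ probeCell d c)]
    (hsmall : H * ((d : ℝ) + 2) * Real.exp (-(1 / ((d : ℝ) + 2) * K / 8)) ≤ δ) :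
    ENNReal.ofReal (1 - δ) ≤ hardLaw d H K ρ ξ {D | ∀ h c, 1 / ((d : ℝ) + 2) * K / 2 ≤
      ∑ τ, if ((D τ h).1, (D τ h).2.1) ∈ probeCell d c then (1 : ℝ) else 0} := by
  have hprob := hardLaw_isProbabilityMeasure (K := K) (ρ := ρ) hH ξ
  set bad : Fin H × Option (Option (Fin d)) → Set (Dataset HState (HAction d) H K) := fun p =>
    {D | ∑ τ, (if ((D τ p.1).1, (D τ p.1).2.1) ∈ probeCell d p.2
      then (1 : ℝ) else 0) < 1 / ((d : ℝ) + 2) * K / 2} with hbad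
  set good : Set (Dataset HState (HAction d) H K) := {D | ∀ h c, 1 / ((d : ℝ) + 2) * K / 2 ≤
      ∑ τ, if ((D τ h).1, (D τ h).2.1) ∈ probeCell d c then (1 : ℝ) else 0} with hgood
  have hcover : Set.univ ⊆ good ∪ ⋃ p, bad p := by
    intro D _
    by_cases hD : D ∈ good
    · exact Or.inl hD
    · refine Or.inr (Set.mem_iUnion.2 ?_)
      simp only [hgood, Set.mem_ofPred_eq, not_forall, not_le] at hD
      obtain ⟨h, c, hc⟩ := hD
      exact ⟨(h, c), hc⟩
  have hbadle : hardLaw d H K ρ ξ (⋃ p, bad p) ≤ ENNReal.ofReal δ := by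
    calc _ ≤ ∑ p, hardLaw d H K ρ ξ (bad p) := measure_iUnion_fintype_le _ _
      _ ≤ ∑ _p : Fin H × Option (Option (Fin d)),
          ENNReal.ofReal (Real.exp (-(1 / ((d : ℝ) + 2) * K / 8))) :=
        Finset.sum_le_sum fun p _ => hardLaw_count_lt_le ξ p.1 p.2
      _ = ENNReal.ofReal (H * ((d : ℝ) + 2) * Real.exp (-(1 / ((d : ℝ) + 2) * K / 8))) := by
        rw [ENNReal.ofReal_mul (by positivity), Finset.sum_const, nsmul_eq_mul, Finset.card_univ]
        congr 1
        rw [← ENNReal.ofReal_natCast]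
        congr 1
        simp [Fintype.card_prod, Fintype.card_option]
        left
        ring
      _ ≤ _ := ENNReal.ofReal_le_ofReal hsmall
  rw [ENNReal.ofReal_sub _ hδ, ENNReal.ofReal_one, tsub_le_iff_right, ← hprob.measure_univ]
  exact (measure_mono hcover).trans ((measure_union_le _ _).trans (by gcongr))

end Coverage

/-! ### Choice of the constants -/

/-- What the sample size condition gives: the union bound over all cells succeeds, the gap is at
most `1`, and `d ≤ K`. -/
theorem of_sampleSize {d H K : ℕ} {δ : ℝ} (hd : 1 ≤ d) (hH : 1 ≤ H) (hδ : 0 < δ) (hδ1 : δ < 1)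
    (hK : 100 * (d : ℝ) ^ 6 * Real.log (2 * d * H / δ) < K) :
    H * ((d : ℝ) + 2) * Real.exp (-(1 / ((d : ℝ) + 2) * K / 8)) ≤ δ ∧ gap d K ≤ 1 ∧ d ≤ K := by
  have hd' : (1 : ℝ) ≤ d := by exact_mod_cast hd
  have hH' : (1 : ℝ) ≤ H := by exact_mod_cast hH
  set y : ℝ := 2 * d * H / δ with hy
  have hy2 : 2 ≤ y := by
    rw [hy, le_div_iff₀ hδ]
    nlinarith [mul_nonneg (sub_nonneg.2 hd') (sub_nonneg.2 hH')]
  have hy0 : 0 < y := by linarith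
  have hlog : 1 / 2 ≤ Real.log y := by
    have h1 := Real.log_two_gt_d9
    have h2 := Real.log_le_log (by norm_num) hy2
    linarith
  have hpow : ∀ m, m ≤ 6 → (d : ℝ) ^ m ≤ (d : ℝ) ^ 6 := fun m hm => pow_le_pow_right₀ hd' hm
  have hKd : (d : ℝ) ^ 6 ≤ K := by
    have : (0 : ℝ) ≤ (d : ℝ) ^ 6 := by positivity
    nlinarith
  have hK0 : (0 : ℝ) < K := lt_of_lt_of_le (by positivity) hKd
  refine ⟨?_, ?_, ?_⟩
  -- The failure probability of a cell is at most `exp (-2 log y) = y⁻²`, against `H (d + 2)` cells.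
  · have hexp : 2 * Real.log y ≤ 1 / ((d : ℝ) + 2) * K / 8 := by
      rw [one_div_mul_eq_div, div_div, le_div_iff₀ (by positivity)]
      have h1 : (d : ℝ) ≤ (d : ℝ) ^ 6 := by simpa using hpow 1 (by norm_num)
      have h2 : (0 : ℝ) ≤ Real.log y := by linarith
      have h3 := mul_le_mul_of_nonneg_right h1 h2
      have h4 := mul_le_mul_of_nonneg_right hd' h2
      nlinarith
    have h1 : Real.exp (-(1 / ((d : ℝ) + 2) * K / 8)) ≤ (y ^ 2)⁻¹ := by
      calc _ ≤ Real.exp (-(2 * Real.log y)) := Real.exp_le_exp.2 (by linarith)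
        _ = _ := by
          rw [Real.exp_neg, mul_comm, Real.exp_mul, Real.exp_log hy0]
          norm_num
    calc _ ≤ H * (3 * (d : ℝ)) * (y ^ 2)⁻¹ := by gcongr; linarith
      _ = 3 * δ ^ 2 / (4 * (d * H)) := by rw [hy]; field_simp; ring
      _ ≤ δ := by
        rw [div_le_iff₀ (by positivity)]
        have h2 : (1 : ℝ) ≤ d * H := by nlinarith
        nlinarith
  · have h1 : gap d K ^ 2 ≤ 1 := by
      rw [sq_gap]
      refine div_le_one_of_le₀ ?_ (by positivity)
      have := hpow 3 (by norm_num)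
      linarith
    exact (sq_le_one_iff₀ (gap_nonneg d K)).1 h1
  · have h1 : (d : ℝ) ≤ (d : ℝ) ^ 6 := by simpa using hpow 1 (by norm_num)
    exact_mod_cast h1.trans hKd

end RobustRL

theorem mainTheorem7 :
    ∃ c C : ℝ, 0 < c ∧ 0 < C ∧
      ∀ (d H K : ℕ) (ρ δ lam : ℝ), 1 ≤ d → 1 ≤ H → 0 < ρ → ρ ≤ 3 / 4 → 0 < δ → δ < 1 → 0 < lam →
        C * (d : ℝ) ^ 6 * Real.log (2 * d * H / δ) < K →
        (∀ ξ : Fin H → Fin d → ℤˣ,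
          (RobustRL.hardInstance d H K ρ ξ).IsLinear ∧
          (RobustRL.hardInstance d H K ρ ξ).FeatureCoverage (RobustRL.hardInit d)
            (RobustRL.behavior d H) ∧
          IsProbabilityMeasure (RobustRL.hardLaw d H K ρ ξ) ∧
          (∃ πstar, (RobustRL.hardInstance d H K ρ ξ).IsOptimal πstar) ∧
          (∀ (D : RobustRL.Dataset RobustRL.HState (RobustRL.HAction d) H K) (h : Fin H),
            (RobustRL.hardInstance d H K ρ ξ).weightedCov lam D h =
              (RobustRL.hardInstance d H K ρ ξ).empCov lam D h)) ∧
        ∀ ξ : Fin H → Fin d → ℤˣ,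
          ENNReal.ofReal (1 - δ) ≤ RobustRL.hardLaw d H K ρ ξ
            {D | ∀ (ξ' : Fin H → Fin d → ℤˣ)
                (πstar : RobustRL.Policy RobustRL.HState (RobustRL.HAction d) H),
              (RobustRL.hardInstance d H K ρ ξ').IsOptimal πstar →
              ENNReal.ofReal (c * (RobustRL.hardInstance d H K ρ ξ').uncertaintyFn
                  ((RobustRL.hardInstance d H K ρ ξ').empCov lam D) πstar 0) ≤
                RobustRL.minimaxRisk d H K ρ 0} := by
  classical
  -- `uncertaintyFn ≤ 5 H gap` and `minimaxRisk ≥ H gap / 64`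
  refine ⟨1 / 320, 100, by norm_num, by norm_num, ?_⟩
  intro d H K ρ δ lam hd hH hρ hρ1 hδ hδ1 hlam hK
  obtain ⟨hsmall, hgap, hdK⟩ := RobustRL.of_sampleSize hd hH hδ hδ1 hK
  have hρ1' : ρ ≤ 1 := by linarith
  refine ⟨fun ξ => ⟨RobustRL.hardInstance_isLinear hρ.le hgap ξ,
    RobustRL.hardInstance_featureCoverage hd ξ, RobustRL.hardLaw_isProbabilityMeasure hH ξ,
    ⟨_, RobustRL.oraclePolicy_isOptimal hρ.le hρ1' hgap ξ⟩,
    RobustRL.weightedCov_eq_empCov lam ξ⟩, fun ξ => ?_⟩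
  refine (RobustRL.one_sub_le_hardLaw_counts hδ.le hH ξ hsmall).trans (measure_mono ?_)
  intro D hD ξ' πstar _
  refine le_trans (ENNReal.ofReal_le_ofReal ?_)
    (RobustRL.le_minimaxRisk hd hH hdK hρ.le hρ1 hgap)
  have := RobustRL.uncertaintyFn_le hd (by omega) hρ.le hρ1' hgap hlam ξ' D hD πstar 0
  linarith
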